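/- Let $n\ge 2$ be an integer and let $C_m=C_m^{(5/2)}$ denote the Gegenbauer polynomials (orthogonal on $[-1,1]$ for the weight $(1-x^2)^2$), with $C_m=0$ for $m<0$. Put $$\delta=\sqrt{3n(n+2)(n^2+2n-2)},$$ $$R_{n-1}=(n-1)(2n^2+2n-3)\,C_{n-1}+(2\delta+3-n-6n^2-2n^3)\,C_{n-2},$$ $$S_{n-2}=\bigl(3(n+2)(2n^2-1)-2\delta\bigr)C_{n-2}+(n+2)(2n^2+2n-3)\,C_{n-3},$$ $$A=\tfrac{2}{9}(n-1)n(n+1)(n+2)(2n+1)(2n^2+2n-3)^2 .$$ Then $R_{n-1}$ has degree $n-1$ and exactly $n-1$ roots $x_2,\dots,x_n$, all real, simple and contained in $(-1,1)$, and $S_{n-2}(x_i)\neq 0$ for $i=2,\dots,n$. Put $x_1=-1$ and $$w_1=\frac{8(2n^2+4n-3)(2n^4+8n^3+4n^2-8n-3-\delta)}{3(n-1)n(n+2)(n+3)(n^2+2n-2)(n+1)^2},$$ $$w_i=\frac{A}{R_{n-1}'(x_i)\,S_{n-2}(x_i)\,(1+x_i)(1-x_i)^2}\qquad(i=2,\dots,n).$$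 The two-interval rule has on the first interval (in the reference coordinate $[-1,1]$) the $n$ nodes $x_1,\dots,x_n$ with weights $w_1,\dots,w_n$, and on the second interval the $n-1$ reflected nodes $-x_2,\dots,-x_n$ with the same weights $w_2,\dots,w_n$. Its periodic repetition is exact for $C^1$ splines of degree at most $2n$ on the real line with uniform knots: let $a\in\mathbb R$, $h>0$, and let $s\in C^1(\mathbb R)$ be integrable over $\mathbb R$ (for instance compactly supported) and coincide on every interval $[a+kh,a+(k+1)h]$, $k\in\mathbb Z$, with a polynomial of degree at most $2n$. Then $$\int_{\mathbb R}s(x)\,dx=\sum_{k\in\mathbb Z}\frac h2\Bigl[\sum_{i=1}^{n}w_i\,s\bigl(a+2kh+\tfrac h2(1+x_i)\bigr)+\sum_{i=2}^{n}w_i\,s\bigl(a+(2k+1)h+\tfrac h2(1-x_i)\bigr)\Bigr],$$ where the sum over $k$ converges absolutely. -/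

import Mathlib

open Polynomial MeasureTheory

noncomputable section

/-- The Gegenbauer (ultraspherical) polynomial `C_m^{(l)}`, by its three-term recurrence
`(m+2) C_{m+2} = 2 (m+1+l) x C_{m+1} - (m+2l) C_m`. -/
def gegenbauer (l : ℝ) : ℕ → ℝ[X]
  | 0 => 1
  | 1 => C (2 * l) * X
  | m + 2 => C (2 * ((m : ℝ) + 1 + l) / ((m : ℝ) + 2)) * X * gegenbauer l (m + 1)
      - C (((m : ℝ) + 2 * l) / ((m : ℝ) + 2)) * gegenbauer l m

/-- `C_m = C_m^{(5/2)}`, with integer index and the usual convention `C_m = 0` for `m < 0`. -/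
def geg52 : ℤ → ℝ[X]
  | Int.ofNat m => gegenbauer (5 / 2) m
  | Int.negSucc _ => 0

/-- A spline of degree at most `D` and class `C^r` on the real line, with the uniform knots
`a + k h`, `k ∈ ℤ`. -/
def IsUniformSpline (r D : ℕ) (a h : ℝ) (s : ℝ → ℝ) : Prop :=
  ContDiff ℝ r s ∧
    ∀ k : ℤ, ∃ p : ℝ[X], p.natDegree ≤ D ∧
      ∀ x ∈ Set.Icc (a + (k : ℝ) * h) (a + ((k : ℝ) + 1) * h), s x = p.eval x

/-- Finitely many nodes with weights, relative to the reference interval `[-1, 1]`. -/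
structure NodesWeights where
  nodes : Finset ℝ
  weight : ℝ → ℝ

/-- The quadrature sum on the interval `[u, u + h]`: the nodes are transported from `[-1, 1]`
by the increasing affine map, and the weights are multiplied by half the interval length. -/
def NodesWeights.sumOn (Q : NodesWeights) (u h : ℝ) (f : ℝ → ℝ) : ℝ :=
  ∑ x ∈ Q.nodes, h / 2 * Q.weight x * f (u + h * (x + 1) / 2)

namespace HalfRule

/-- The constant `δ`. -/
def delta (n : ℕ) : ℝ :=
  Real.sqrt (3 * (n : ℝ) * ((n : ℝ) + 2) * ((n : ℝ) ^ 2 + 2 * (n : ℝ) - 2))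

/-- The polynomial `R_{n-1}`. -/
def polyR (n : ℕ) : ℝ[X] :=
  C (((n : ℝ) - 1) * (2 * (n : ℝ) ^ 2 + 2 * (n : ℝ) - 3)) * geg52 ((n : ℤ) - 1)
    + C (2 * delta n + 3 - (n : ℝ) - 6 * (n : ℝ) ^ 2 - 2 * (n : ℝ) ^ 3) * geg52 ((n : ℤ) - 2)

/-- The polynomial `S_{n-2}`. -/
def polyS (n : ℕ) : ℝ[X] :=
  C (3 * ((n : ℝ) + 2) * (2 * (n : ℝ) ^ 2 - 1) - 2 * delta n) * geg52 ((n : ℤ) - 2)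
    + C (((n : ℝ) + 2) * (2 * (n : ℝ) ^ 2 + 2 * (n : ℝ) - 3)) * geg52 ((n : ℤ) - 3)

/-- The constant `A`. -/
def constA (n : ℕ) : ℝ :=
  2 * ((n : ℝ) - 1) * (n : ℝ) * ((n : ℝ) + 1) * ((n : ℝ) + 2) * (2 * (n : ℝ) + 1)
    * (2 * (n : ℝ) ^ 2 + 2 * (n : ℝ) - 3) ^ 2 / 9

/-- The weight `w_1` of the node `-1`. -/
def endWeight (n : ℕ) : ℝ :=
  8 * (2 * (n : ℝ) ^ 2 + 4 * (n : ℝ) - 3)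
      * (2 * (n : ℝ) ^ 4 + 8 * (n : ℝ) ^ 3 + 4 * (n : ℝ) ^ 2 - 8 * (n : ℝ) - 3 - delta n)
    / (3 * ((n : ℝ) - 1) * (n : ℝ) * ((n : ℝ) + 2) * ((n : ℝ) + 3)
      * ((n : ℝ) ^ 2 + 2 * (n : ℝ) - 2) * ((n : ℝ) + 1) ^ 2)

/-- The weight of an interior node `x`, a root of `R_{n-1}`. -/
def interiorWeight (n : ℕ) (x : ℝ) : ℝ :=
  constA n / ((derivative (polyR n)).eval x * (polyS n).eval x * (1 + x) * (1 - x) ^ 2)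

/-- The first interval: the node `-1` and the roots of `R_{n-1}`. -/
def first (n : ℕ) : NodesWeights where
  nodes := insert (-1) (polyR n).roots.toFinset
  weight x := if x = -1 then endWeight n else interiorWeight n x

/-- The second interval: the reflected roots of `R_{n-1}`, with the same weights. -/
def second (n : ℕ) : NodesWeights where
  nodes := (polyR n).roots.toFinset.image (fun x => -x)
  weight x := interiorWeight n (-x)

end HalfRule

end

open Polynomial MeasureTheory

noncomputable section

/-! Everything rests on a rule on one interval that also uses derivatives at the end points. Put n =
m + 2 and L(p) = ∫p - (w_1/2) p(-1) - α p'(-1) - β p'(1) (`interiorPart`). Since C_m is the second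
derivative of a multiple of the Legendre polynomial P_{m+2}, the integral of R_{n-1} q with deg q ≤
n + 1 depends only on the values and first derivatives of q at ±1 (`polyInt_polyR_mul`). The numbers
α, β absorb the q' terms, δ removes the value at 1 (`polyR_boundary_one`), and w_1 fits the value at
-1 (`polyR_boundary_neg_one`). So L annihilates R_{n-1} q, and interpolation at the n - 1 zeros is
exact up to degree (n - 1) + (n + 1) = 2n (`polyInt_eq_rule`).

The zeros are real, simple and interior because R_{n-1} is orthogonal to degrees below n - 2 and has
suitable signs at ±1 (`roots_of_quasiOrthogonal`).

The second interval carries the mirror image of the rule. As s is C^1, the derivative terms cancel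
at every knot, and the halves w_1/2 add up at every other knot. A pair of intervals thus has error
G(k) - G(k+1). This sums to zero because the knot data are bounded by local L^1 norms of s, hence
summable (`exists_endpoint_bound`). -/

namespace HalfRule

/-! ### Gegenbauer polynomials: recurrence, differential equation, end point values -/

/-- The Gegenbauer polynomial `C_m^{(5/2)}`. -/
abbrev geg (m : ℕ) : ℝ[X] := gegenbauer (5 / 2) m

theorem geg_zero : geg 0 = 1 := by simp [geg, gegenbauer]

theorem geg_one : geg 1 = 5 * X := by
  have : (C (2 * (5 / 2 : ℝ))) = (5 : ℝ[X]) := by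
    norm_num
    rfl
  simp only [geg, gegenbauer, this]

theorem C_natCast_add_ofNat (a b m : ℕ) :
    C ((a : ℝ) * m + b) = (a : ℝ[X]) * (m : ℝ[X]) + (b : ℝ[X]) := by
  simp

theorem geg_rec (m : ℕ) :
    ((m : ℝ[X]) + 2) * geg (m + 2)
      = (2 * (m : ℝ[X]) + 7) * X * geg (m + 1) - ((m : ℝ[X]) + 5) * geg m := by
  have hm : (m : ℝ) + 2 ≠ 0 := by positivity
  have h2 : ((m : ℝ[X]) + 2) = C ((m : ℝ) + 2) := by simpa using (C_natCast_add_ofNat 1 2 m).symm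
  have h7 : (2 * (m : ℝ[X]) + 7) = C (2 * (m : ℝ) + 7) := by
    simpa using (C_natCast_add_ofNat 2 7 m).symm
  have h5 : ((m : ℝ[X]) + 5) = C ((m : ℝ) + 5) := by simpa using (C_natCast_add_ofNat 1 5 m).symm
  have e : geg (m + 2) = C (2 * ((m : ℝ) + 1 + 5 / 2) / ((m : ℝ) + 2)) * X * geg (m + 1)
      - C (((m : ℝ) + 2 * (5 / 2)) / ((m : ℝ) + 2)) * geg m := by
    simp only [geg, gegenbauer]
  rw [h2, h7, h5, e, mul_sub, ← mul_assoc, ← mul_assoc, ← mul_assoc, ← C_mul, ← C_mul]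
  congr 4
  · field_simp; ring
  · field_simp

theorem natCast_add_one_ne_zero (m k : ℕ) : (m : ℝ[X]) + ((k + 1 : ℕ) : ℝ[X]) ≠ 0 := by
  rw [← Nat.cast_add]
  exact Nat.cast_ne_zero.mpr (by omega)

/-- The two relations are proved together: the first at m + 1 is the second at m plus the
recurrence, and the second at m + 1 comes from the differentiated recurrence. -/
theorem geg_derivative_aux (m : ℕ) :
    (1 - X ^ 2) * derivative (geg m) = ((m : ℝ[X]) + 5) * X * geg m - ((m : ℝ[X]) + 1) * geg (m + 1)
    ∧ (1 - X ^ 2) * derivative (geg (m + 1))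
      = ((m : ℝ[X]) + 5) * geg m - ((m : ℝ[X]) + 1) * X * geg (m + 1) := by
  induction m with
  | zero =>
    rw [zero_add, geg_zero, geg_one]
    constructor
    · simp
    · simp [derivative_mul]
      ring
  | succ m ih =>
    obtain ⟨ih2, ih1⟩ := ih
    have hr := geg_rec m
    have hd := congrArg derivative hr
    simp only [derivative_mul, derivative_add, derivative_sub, derivative_natCast,
      derivative_ofNat, derivative_X] at hd
    have h2 : (m : ℝ[X]) + 2 ≠ 0 := by exact_mod_cast natCast_add_one_ne_zero m 1
    push_cast
    constructor
    · linear_combination ih1 + hr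
    · apply mul_left_cancel₀ h2
      linear_combination (1 - X ^ 2) * hd + (2 * (m : ℝ[X]) + 7) * X * ih1
        - ((m : ℝ[X]) + 5) * ih2 + ((m : ℝ[X]) + 2) * X * hr

theorem one_sub_X_sq_ne_zero : (1 - X ^ 2 : ℝ[X]) ≠ 0 := by
  intro h
  have := congrArg (eval 0) h
  simp at this

/-- The Gegenbauer differential equation. -/
theorem geg_ode (m : ℕ) :
    (1 - X ^ 2) * derivative (derivative (geg m)) - 6 * X * derivative (geg m)
      + (m : ℝ[X]) * ((m : ℝ[X]) + 5) * geg m = 0 := by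
  obtain ⟨h2, h1⟩ := geg_derivative_aux m
  have hd := congrArg derivative h2
  simp only [derivative_mul, derivative_add, derivative_sub, derivative_natCast, derivative_one,
      derivative_ofNat, derivative_X, derivative_X_pow] at hd
  apply mul_left_cancel₀ one_sub_X_sq_ne_zero
  simp only [map_natCast] at hd
  push_cast at hd
  linear_combination (1 - X ^ 2) * hd - ((m : ℝ[X]) + 1) * h1
    + (((m : ℝ[X]) + 5) * X - 4 * X) * h2

theorem geg_eval_one (m : ℕ) :
    (geg m).eval 1 = ((m : ℝ) + 1) * ((m : ℝ) + 2) * ((m : ℝ) + 3) * ((m : ℝ) + 4) / 24 := by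
  induction m using Nat.twoStepInduction with
  | zero => rw [geg_zero]; norm_num
  | one => rw [geg_one]; norm_num
  | more m h0 h1 =>
    have h := congrArg (eval 1) (geg_rec m)
    simp only [eval_mul, eval_add, eval_sub, eval_natCast, eval_ofNat, eval_X, h0, h1] at h
    have hm : (m : ℝ) + 2 ≠ 0 := by positivity
    apply mul_left_cancel₀ hm
    rw [h]
    push_cast
    ring

theorem geg_eval_neg (m : ℕ) (x : ℝ) : (geg m).eval (-x) = (-1) ^ m * (geg m).eval x := by
  induction m using Nat.twoStepInduction with
  | zero => rw [geg_zero]; norm_num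
  | one => rw [geg_one]; norm_num
  | more m h0 h1 =>
    have h := congrArg (eval x) (geg_rec m)
    have h' := congrArg (eval (-x)) (geg_rec m)
    simp only [eval_mul, eval_add, eval_sub, eval_natCast, eval_ofNat, eval_X, h0, h1] at h h'
    have hm : (m : ℝ) + 2 ≠ 0 := by positivity
    apply mul_left_cancel₀ hm
    rw [h']
    linear_combination (-(-1) ^ m) * h

theorem geg_eval_neg_one (m : ℕ) :
    (geg m).eval (-1)
      = (-1) ^ m * (((m : ℝ) + 1) * ((m : ℝ) + 2) * ((m : ℝ) + 3) * ((m : ℝ) + 4) / 24) := by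
  rw [geg_eval_neg, geg_eval_one]

theorem geg_derivative_eval_one (m : ℕ) :
    (derivative (geg m)).eval 1 = (m : ℝ) * ((m : ℝ) + 5) / 6 * (geg m).eval 1 := by
  have h := congrArg (eval 1) (geg_ode m)
  simp at h
  linear_combination (-1 / 6) * h

theorem geg_derivative_eval_neg_one (m : ℕ) :
    (derivative (geg m)).eval (-1) = -((m : ℝ) * ((m : ℝ) + 5) / 6 * (geg m).eval (-1)) := by
  have h := congrArg (eval (-1)) (geg_ode m)
  simp at h
  linear_combination (1 / 6) * h

/-! ### Iterated antiderivatives -/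

/-- An antiderivative of `C_m^{(5/2)}`, a multiple of `P_{m+2}'`. -/
def gegF (m : ℕ) : ℝ[X] :=
  C (1 / (((m : ℝ) + 1) * ((m : ℝ) + 4))) * (4 * X * geg m - (1 - X ^ 2) * derivative (geg m))

/-- A second antiderivative of `C_m^{(5/2)}`, a multiple of the Legendre polynomial `P_{m+2}`. -/
def gegE (m : ℕ) : ℝ[X] :=
  C (1 / (((m : ℝ) + 2) * ((m : ℝ) + 3))) * (2 * X * gegF m - (1 - X ^ 2) * geg m)

theorem gegF_spec (m : ℕ) :
    ((m : ℝ[X]) + 1) * ((m : ℝ[X]) + 4) * gegF m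
      = 4 * X * geg m - (1 - X ^ 2) * derivative (geg m) := by
  have h : ((m : ℝ[X]) + 1) * ((m : ℝ[X]) + 4) = C (((m : ℝ) + 1) * ((m : ℝ) + 4)) := by
    simp [map_ofNat]
  rw [h, gegF, ← mul_assoc, ← C_mul, mul_one_div_cancel (by positivity), C_1, one_mul]

theorem gegE_spec (m : ℕ) :
    ((m : ℝ[X]) + 2) * ((m : ℝ[X]) + 3) * gegE m
      = 2 * X * gegF m - (1 - X ^ 2) * geg m := by
  have h : ((m : ℝ[X]) + 2) * ((m : ℝ[X]) + 3) = C (((m : ℝ) + 2) * ((m : ℝ) + 3)) := by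
    simp [map_ofNat]
  rw [h, gegE, ← mul_assoc, ← C_mul, mul_one_div_cancel (by positivity), C_1, one_mul]

/-- By the differential equation, the derivative of 4xC_m - (1 - x²)C_m' is (4 + m(m+5))C_m =
(m+1)(m+4)C_m. -/
theorem derivative_gegF (m : ℕ) : derivative (gegF m) = geg m := by
  have h1 : (m : ℝ[X]) + 1 ≠ 0 := by exact_mod_cast natCast_add_one_ne_zero m 0
  have h4 : (m : ℝ[X]) + 4 ≠ 0 := by exact_mod_cast natCast_add_one_ne_zero m 3
  have hd := congrArg derivative (gegF_spec m)
  simp only [derivative_mul, derivative_add, derivative_sub, derivative_natCast, derivative_one,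
      derivative_ofNat, derivative_X, derivative_X_pow, map_natCast] at hd
  push_cast at hd
  apply mul_left_cancel₀ (mul_ne_zero h1 h4)
  linear_combination hd - geg_ode m

theorem derivative_gegE (m : ℕ) : derivative (gegE m) = gegF m := by
  have h1 : (m : ℝ[X]) + 2 ≠ 0 := by exact_mod_cast natCast_add_one_ne_zero m 1
  have h4 : (m : ℝ[X]) + 3 ≠ 0 := by exact_mod_cast natCast_add_one_ne_zero m 2
  have hd := congrArg derivative (gegE_spec m)
  simp only [derivative_mul, derivative_add, derivative_sub, derivative_natCast, derivative_one,
      derivative_ofNat, derivative_X, derivative_X_pow, map_natCast, derivative_gegF] at hd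
  push_cast at hd
  apply mul_left_cancel₀ (mul_ne_zero h1 h4)
  linear_combination hd - gegF_spec m

/-- With the next lemma this makes the second derivative of (1 - x²)² C_m a constant times `gegE m`,
a Rodrigues formula that carries orthogonality from the weight (1 - x²)² to the weight 1. -/
theorem derivative_weight_mul_gegF (m : ℕ) :
    derivative ((1 - X ^ 2) * gegF m) = -(((m : ℝ[X]) + 2) * ((m : ℝ[X]) + 3)) * gegE m := by
  simp only [derivative_mul, derivative_sub, derivative_one, derivative_X_pow, map_natCast,
    derivative_gegF]
  push_cast
  linear_combination gegE_spec m

theorem derivative_weight_mul_geg (m : ℕ) :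
    derivative ((1 - X ^ 2) ^ 2 * geg m)
      = -(((m : ℝ[X]) + 1) * ((m : ℝ[X]) + 4)) * ((1 - X ^ 2) * gegF m) := by
  simp only [derivative_mul, derivative_sub, derivative_one, derivative_X, derivative_pow,
    map_natCast]
  push_cast
  linear_combination (1 - X ^ 2) * gegF_spec m

theorem gegF_eval_one (m : ℕ) : (gegF m).eval 1 = ((m : ℝ) + 2) * ((m : ℝ) + 3) / 6 := by
  have h := congrArg (eval 1) (gegF_spec m)
  simp [geg_eval_one] at h
  apply mul_left_cancel₀ (show ((m : ℝ) + 1) * ((m : ℝ) + 4) ≠ 0 by positivity)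
  rw [h]; ring

theorem gegF_eval_neg_one (m : ℕ) :
    (gegF m).eval (-1) = -((-1) ^ m * (((m : ℝ) + 2) * ((m : ℝ) + 3) / 6)) := by
  have h := congrArg (eval (-1)) (gegF_spec m)
  simp [geg_eval_neg_one] at h
  apply mul_left_cancel₀ (show ((m : ℝ) + 1) * ((m : ℝ) + 4) ≠ 0 by positivity)
  rw [h]; ring

theorem gegE_eval_one (m : ℕ) : (gegE m).eval 1 = 1 / 3 := by
  have h := congrArg (eval 1) (gegE_spec m)
  simp [gegF_eval_one] at h
  apply mul_left_cancel₀ (show ((m : ℝ) + 2) * ((m : ℝ) + 3) ≠ 0 by positivity)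
  rw [h]; ring

theorem gegE_eval_neg_one (m : ℕ) : (gegE m).eval (-1) = (-1) ^ m / 3 := by
  have h := congrArg (eval (-1)) (gegE_spec m)
  simp [gegF_eval_neg_one] at h
  apply mul_left_cancel₀ (show ((m : ℝ) + 2) * ((m : ℝ) + 3) ≠ 0 by positivity)
  rw [h]; ring

theorem natDegree_geg_le (m : ℕ) : (geg m).natDegree ≤ m := by
  induction m using Nat.twoStepInduction with
  | zero => rw [geg_zero]; simp
  | one =>
    rw [geg_one]
    compute_degree
  | more m h0 h1 =>
    simp only [geg, gegenbauer] at *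
    compute_degree
    omega

theorem coeff_geg_succ (m : ℕ) :
    ((m : ℝ) + 1) * (geg (m + 1)).coeff (m + 1) = (2 * (m : ℝ) + 5) * (geg m).coeff m := by
  cases m with
  | zero => rw [zero_add, geg_zero, geg_one]; simp [coeff_ofNat_mul]
  | succ m =>
    have h := congrArg (fun p => coeff p (m + 2)) (geg_rec m)
    have h2 : ((m : ℝ[X]) + 2) = C ((m : ℝ) + 2) := by
      simpa using (C_natCast_add_ofNat 1 2 m).symm
    have h7 : (2 * (m : ℝ[X]) + 7) = C (2 * (m : ℝ) + 7) := by
      simpa using (C_natCast_add_ofNat 2 7 m).symm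
    have h5 : ((m : ℝ[X]) + 5) = C ((m : ℝ) + 5) := by
      simpa using (C_natCast_add_ofNat 1 5 m).symm
    have h0 : (geg m).coeff (m + 2) = 0 :=
      coeff_eq_zero_of_natDegree_lt (lt_of_le_of_lt (natDegree_geg_le m) (by omega))
    simp only [h2, h7, h5, mul_assoc, coeff_sub, coeff_C_mul, h0, coeff_X_mul] at h
    push_cast
    linear_combination h

/-! ### Integration and orthogonality -/

/-- Integration of polynomials over `[-1, 1]`. -/
def polyInt : ℝ[X] →ₗ[ℝ] ℝ where
  toFun p := ∫ x in (-1 : ℝ)..1, p.eval x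
  map_add' p q := by
    simp only [eval_add]
    exact intervalIntegral.integral_add (p.continuous.intervalIntegrable _ _)
      (q.continuous.intervalIntegrable _ _)
  map_smul' c p := by
    simp only [eval_smul, smul_eq_mul, RingHom.id_apply]
    exact intervalIntegral.integral_const_mul _ _

theorem polyInt_apply (p : ℝ[X]) : polyInt p = ∫ x in (-1 : ℝ)..1, p.eval x := rfl

theorem polyInt_derivative (p : ℝ[X]) : polyInt (derivative p) = p.eval 1 - p.eval (-1) :=
  intervalIntegral.integral_eq_sub_of_hasDerivAt (fun x _ => p.hasDerivAt x)
    ((derivative p).continuous.intervalIntegrable _ _)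

theorem polyInt_C_mul (c : ℝ) (p : ℝ[X]) : polyInt (C c * p) = c * polyInt p := by
  rw [← smul_eq_C_mul, map_smul, smul_eq_mul]

theorem linearMap_eq_sum_coeff (f : ℝ[X] →ₗ[ℝ] ℝ) {q : ℝ[X]} {m : ℕ} (hq : q.natDegree < m) :
    f q = ∑ i ∈ Finset.range m, q.coeff i * f (X ^ i) := by
  conv_lhs => rw [q.as_sum_range_C_mul_X_pow' hq]
  rw [map_sum]
  refine Finset.sum_congr rfl fun i _ => ?_
  rw [← smul_eq_C_mul, map_smul, smul_eq_mul]

/-- The functional `q ↦ ∫ (1 - x²)² p q`. -/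
def weightInt (p : ℝ[X]) : ℝ[X] →ₗ[ℝ] ℝ :=
  polyInt ∘ₗ LinearMap.mulLeft ℝ ((1 - X ^ 2) ^ 2 * p)

theorem weightInt_apply (p q : ℝ[X]) : weightInt p q = polyInt ((1 - X ^ 2) ^ 2 * p * q) := rfl

/-- Sturm–Liouville form: (1 - x²)² C_{m+1} is a multiple of the derivative of (1 - x²)³ C_{m+1}',
which vanishes at ±1. The eigenvalue is nonzero because the index is positive. -/
theorem weightInt_geg_one (m : ℕ) : weightInt (geg (m + 1)) 1 = 0 := by
  have h : derivative ((1 - X ^ 2) ^ 3 * derivative (geg (m + 1)))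
      = C (-((m + 1 : ℝ) * (m + 6))) * ((1 - X ^ 2) ^ 2 * geg (m + 1) * 1) := by
    have hc : C (-((m + 1 : ℝ) * (m + 6))) = -(((m : ℝ[X]) + 1) * ((m : ℝ[X]) + 6)) := by
      simp [map_ofNat]
    rw [hc]
    simp only [derivative_mul, derivative_sub, derivative_one, derivative_X, derivative_pow,
      map_natCast]
    have := geg_ode (m + 1)
    push_cast at this ⊢
    linear_combination (1 - X ^ 2) ^ 2 * this
  have h2 := congrArg polyInt h
  rw [polyInt_derivative, polyInt_C_mul] at h2
  simp at h2
  rcases h2 with h2 | h2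
  · rcases h2 with h2 | h2 <;> exfalso <;> linarith [Nat.cast_nonneg (α := ℝ) m]
  · rw [weightInt_apply, mul_one, h2]

theorem weightInt_geg_succ_X_pow (m k : ℕ) :
    (2 * (m : ℝ) + 7) * weightInt (geg (m + 1)) (X ^ (k + 1))
      = ((m : ℝ) + 2) * weightInt (geg (m + 2)) (X ^ k)
        + ((m : ℝ) + 5) * weightInt (geg m) (X ^ k) := by
  simp only [weightInt_apply, ← polyInt_C_mul, ← map_add]
  congr 1
  have h2 : C ((m : ℝ) + 2) = ((m : ℝ[X]) + 2) := by simpa using (C_natCast_add_ofNat 1 2 m)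
  have h7 : C (2 * (m : ℝ) + 7) = (2 * (m : ℝ[X]) + 7) := by
    simpa using (C_natCast_add_ofNat 2 7 m)
  have h5 : C ((m : ℝ) + 5) = ((m : ℝ[X]) + 5) := by simpa using (C_natCast_add_ofNat 1 5 m)
  rw [h2, h7, h5]
  linear_combination (-(1 - X ^ 2) ^ 2 * X ^ k) * geg_rec m

/-- The recurrence trades one power of x for the neighbouring indices m - 1 and m + 1, both still
above the lowered exponent. -/
theorem weightInt_geg_X_pow (k : ℕ) : ∀ m, k < m → weightInt (geg m) (X ^ k) = 0 := by
  induction k with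
  | zero =>
    intro m hm
    obtain ⟨m, rfl⟩ := Nat.exists_eq_add_of_lt hm
    simpa using weightInt_geg_one m
  | succ k ih =>
    intro m hm
    obtain ⟨m, rfl⟩ : ∃ j, m = j + 1 := ⟨m - 1, by omega⟩
    have h := weightInt_geg_succ_X_pow m k
    rw [ih m (by omega), ih (m + 2) (by omega)] at h
    have : (2 * (m : ℝ) + 7) ≠ 0 := by positivity
    simpa [this] using h

theorem weightInt_geg_eq_zero {m : ℕ} {q : ℝ[X]} (hq : q.natDegree < m) :
    weightInt (geg m) q = 0 := by
  rw [linearMap_eq_sum_coeff _ hq]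
  refine Finset.sum_eq_zero fun i hi => ?_
  rw [weightInt_geg_X_pow i m (Finset.mem_range.mp hi), mul_zero]

theorem weightInt_geg_eq_coeff {m : ℕ} {q : ℝ[X]} (hq : q.natDegree ≤ m) :
    weightInt (geg m) q = q.coeff m * weightInt (geg m) (X ^ m) := by
  rw [linearMap_eq_sum_coeff _ (Nat.lt_succ_of_le hq), Finset.sum_range_succ]
  rw [Finset.sum_eq_zero fun i hi => ?_, zero_add]
  rw [weightInt_geg_X_pow i m (Finset.mem_range.mp hi), mul_zero]

theorem weightInt_geg_zero : weightInt (geg 0) (X ^ 0) = 16 / 15 := by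
  have h : ((1 - X ^ 2) ^ 2 * geg 0 * X ^ 0)
      = derivative (X - C (2 / 3) * X ^ 3 + C (1 / 5) * X ^ 5 : ℝ[X]) := by
    refine Polynomial.funext fun x => ?_
    rw [geg_zero]
    simp
    ring
  rw [weightInt_apply, h, polyInt_derivative]
  norm_num

/-- The factors 2m + 7 in the two first-order recurrences cancel, so the product grows by
(m+5)/(m+2). It is the constant behind A in the interior weights. -/
theorem coeff_geg_mul_weightInt (m : ℕ) :
    (geg (m + 1)).coeff (m + 1) * weightInt (geg m) (X ^ m)
      = 2 / 9 * ((m : ℝ) + 2) * ((m : ℝ) + 3) * ((m : ℝ) + 4) := by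
  induction m with
  | zero =>
    rw [weightInt_geg_zero, zero_add, geg_one]
    simp [coeff_ofNat_mul]
    norm_num
  | succ m ih =>
    have h1 := coeff_geg_succ (m + 1)
    have h2 := weightInt_geg_succ_X_pow m m
    rw [weightInt_geg_X_pow m (m + 2) (by omega), mul_zero, zero_add] at h2
    have e2 : ((m : ℝ) + 2) * (2 * (m : ℝ) + 7) ≠ 0 := by positivity
    apply mul_left_cancel₀ e2
    push_cast at h1 ⊢
    linear_combination (2 * (m : ℝ) + 7) * weightInt (geg (m + 1)) (X ^ (m + 1)) * h1
      + (2 * (m : ℝ) + 7) * (geg (m + 1)).coeff (m + 1) * h2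
      + (2 * (m : ℝ) + 7) * ((m : ℝ) + 5) * ih

theorem polyInt_by_parts_twice (w r : ℝ[X]) :
    polyInt (derivative (derivative w) * r)
      = (derivative w * r - w * derivative r).eval 1
        - (derivative w * r - w * derivative r).eval (-1)
        + polyInt (w * derivative (derivative r)) := by
  rw [← polyInt_derivative, ← map_add]
  congr 1
  simp only [derivative_mul, derivative_sub]
  ring

theorem natDegree_derivative_derivative_lt {q : ℝ[X]} {m : ℕ} (hm : 0 < m)
    (hq : q.natDegree < m + 2) : (derivative (derivative q)).natDegree < m := by
  have h1 := natDegree_derivative_le q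
  have h2 := natDegree_derivative_le (derivative q)
  omega

theorem derivative_derivative_eq_zero {q : ℝ[X]} (hq : q.natDegree < 2) :
    derivative (derivative q) = 0 := by
  apply derivative_of_natDegree_zero
  have h1 := natDegree_derivative_le q
  omega

/-- Orthogonality of the Legendre polynomials. -/
theorem polyInt_gegE_mul {m : ℕ} {r : ℝ[X]} (hr : r.natDegree < m + 2) :
    polyInt (gegE m * r) = 0 := by
  have h := polyInt_by_parts_twice ((1 - X ^ 2) ^ 2 * geg m) r
  have hw : polyInt ((1 - X ^ 2) ^ 2 * geg m * derivative (derivative r)) = 0 := by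
    -- For m = 0 the strict degree bound would fail, as the zero polynomial has `natDegree` 0.
    rcases Nat.eq_zero_or_pos m with rfl | hm
    · rw [derivative_derivative_eq_zero hr, mul_zero, map_zero]
    · exact weightInt_geg_eq_zero (natDegree_derivative_derivative_lt hm hr)
  have hd : derivative (derivative ((1 - X ^ 2) ^ 2 * geg m)) * r
      = C ((((m : ℝ) + 1) * (m + 4)) * ((m + 2) * (m + 3))) * (gegE m * r) := by
    have e : -(((m : ℝ[X]) + 1) * ((m : ℝ[X]) + 4)) = C (-(((m : ℝ) + 1) * ((m : ℝ) + 4))) := by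
      simp [map_ofNat]
    rw [derivative_weight_mul_geg, e, derivative_C_mul, derivative_weight_mul_gegF]
    simp [map_ofNat]
    ring
  rw [hw, hd, polyInt_C_mul, derivative_weight_mul_geg] at h
  simp at h
  have h1 : (m : ℝ) + 1 ≠ 0 := by positivity
  have h2 : (m : ℝ) + 2 ≠ 0 := by positivity
  have h3 : (m : ℝ) + 3 ≠ 0 := by positivity
  have h4 : (m : ℝ) + 4 ≠ 0 := by positivity
  simpa [h1, h2, h3, h4] using h

/-- Two integrations by parts leave the integral of `gegE m` against q'', of degree at most m + 1,
which vanishes by Legendre orthogonality. -/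
theorem polyInt_geg_mul {m : ℕ} {q : ℝ[X]} (hq : q.natDegree ≤ m + 3) :
    polyInt (geg m * q)
      = (gegF m * q - gegE m * derivative q).eval 1
        - (gegF m * q - gegE m * derivative q).eval (-1) := by
  have h := polyInt_by_parts_twice (gegE m) q
  rwa [derivative_gegE, derivative_gegF, polyInt_gegE_mul, add_zero] at h
  exact natDegree_derivative_derivative_lt (by omega) (by omega)

/-! ### Zeros of quasi-orthogonal polynomials -/

theorem polyInt_pos {p : ℝ[X]} (hp : p ≠ 0) (h : ∀ x ∈ Set.Icc (-1 : ℝ) 1, 0 ≤ p.eval x) :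
    0 < polyInt p := by
  refine intervalIntegral.integral_pos (by norm_num) p.continuous.continuousOn
    (fun x hx => h x ⟨hx.1.le, hx.2⟩) ?_
  by_contra! hc
  refine hp (p.eq_zero_of_infinite_isRoot ((Set.Icc_infinite (show (-1 : ℝ) < 1 by norm_num)).mono
    fun x hx => le_antisymm (hc x hx) (h x hx)))

theorem exists_sign_of_no_root {f : ℝ[X]} (h : ∀ x ∈ Set.Ioo (-1 : ℝ) 1, f.eval x ≠ 0) :
    (∀ x ∈ Set.Icc (-1 : ℝ) 1, 0 ≤ f.eval x) ∨ (∀ x ∈ Set.Icc (-1 : ℝ) 1, f.eval x ≤ 0) := by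
  by_contra! hc
  obtain ⟨⟨x, hx, hfx⟩, ⟨y, hy, hfy⟩⟩ := hc
  have h0 : (0 : ℝ) ∈ Set.uIcc (f.eval x) (f.eval y) := by
    rw [Set.uIcc_of_le (hfx.le.trans hfy.le)]
    exact ⟨hfx.le, hfy.le⟩
  obtain ⟨c, hc, hfc⟩ := intermediate_value_uIcc (f.continuous.continuousOn) h0
  have hcx : c ≠ x := by rintro rfl; exact hfx.ne hfc
  have hcy : c ≠ y := by rintro rfl; exact hfy.ne' hfc
  refine h c ?_ hfc
  rcases Set.mem_uIcc.mp hc with ⟨h1, h2⟩ | ⟨h1, h2⟩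
  · exact ⟨hx.1.trans_lt (lt_of_le_of_ne h1 hcx.symm), (lt_of_le_of_ne h2 hcy).trans_le hy.2⟩
  · exact ⟨hy.1.trans_lt (lt_of_le_of_ne h1 hcy.symm), (lt_of_le_of_ne h2 hcx).trans_le hx.2⟩

/-- A real polynomial can be multiplied by distinct linear factors, one for each of some of its
roots in `(-1, 1)`, so that the product does not change sign on `[-1, 1]`. -/
theorem exists_finset_roots_sign (d : ℕ) : ∀ f : ℝ[X], f ≠ 0 → f.natDegree ≤ d →
    ∃ Z : Finset ℝ, (∀ z ∈ Z, z ∈ Set.Ioo (-1 : ℝ) 1 ∧ f.eval z = 0) ∧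
      ((∀ x ∈ Set.Icc (-1 : ℝ) 1, 0 ≤ (f * ∏ z ∈ Z, (X - C z)).eval x) ∨
        (∀ x ∈ Set.Icc (-1 : ℝ) 1, (f * ∏ z ∈ Z, (X - C z)).eval x ≤ 0)) := by
  induction d with
  | zero =>
    intro f hf hd
    refine ⟨∅, by simp, ?_⟩
    simp only [Finset.prod_empty, mul_one]
    refine exists_sign_of_no_root fun x _ hx => hf ?_
    rw [eq_C_of_natDegree_le_zero hd] at hx ⊢
    rw [eval_C] at hx
    rw [hx, C_0]
  | succ d ih =>
    intro f hf hd
    by_cases hr : ∃ x ∈ Set.Ioo (-1 : ℝ) 1, f.eval x = 0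
    · obtain ⟨c, hc, hfc⟩ := hr
      obtain ⟨g, rfl⟩ := dvd_iff_isRoot.mpr hfc
      have hg : g ≠ 0 := right_ne_zero_of_mul hf
      have hgd : g.natDegree ≤ d := by
        rw [natDegree_mul (X_sub_C_ne_zero c) hg, natDegree_X_sub_C] at hd
        omega
      obtain ⟨Z, hZ, hs⟩ := ih g hg hgd
      -- Z records the roots of odd multiplicity, so one more factor X - c toggles the membership of
      -- c.
      by_cases hcZ : c ∈ Z
      · refine ⟨Z.erase c, fun z hz => ?_, ?_⟩
        · obtain ⟨h1, h2⟩ := hZ z (Finset.mem_of_mem_erase hz)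
          exact ⟨h1, by rw [eval_mul, h2, mul_zero]⟩
        · have : (X - C c) * g * ∏ z ∈ Z.erase c, (X - C z) = g * ∏ z ∈ Z, (X - C z) := by
            rw [← Finset.mul_prod_erase Z _ hcZ]
            ring
          rwa [this]
      · refine ⟨insert c Z, fun z hz => ?_, ?_⟩
        · rcases Finset.mem_insert.mp hz with rfl | hz
          · exact ⟨hc, hfc⟩
          · obtain ⟨h1, h2⟩ := hZ z hz
            exact ⟨h1, by rw [eval_mul, h2, mul_zero]⟩
        · have : (X - C c) * g * ∏ z ∈ insert c Z, (X - C z)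
              = (X - C c) ^ 2 * (g * ∏ z ∈ Z, (X - C z)) := by
            rw [Finset.prod_insert hcZ]
            ring
          rw [this]
          simp only [eval_mul (p := (X - C c) ^ 2), eval_pow]
          exact hs.imp (fun h x hx => mul_nonneg (sq_nonneg _) (h x hx))
            (fun h x hx => mul_nonpos_of_nonneg_of_nonpos (sq_nonneg _) (h x hx))
    · refine ⟨∅, by simp, ?_⟩
      simp only [Finset.prod_empty, mul_one]
      exact exists_sign_of_no_root fun x hx h => hr ⟨x, hx, h⟩

theorem polyInt_weight_mul_ne_zero {p : ℝ[X]} (hp : p ≠ 0)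
    (h : (∀ x ∈ Set.Icc (-1 : ℝ) 1, 0 ≤ p.eval x) ∨ (∀ x ∈ Set.Icc (-1 : ℝ) 1, p.eval x ≤ 0)) :
    polyInt ((1 - X ^ 2) ^ 2 * p) ≠ 0 := by
  have key : ∀ q : ℝ[X], q ≠ 0 → (∀ x ∈ Set.Icc (-1 : ℝ) 1, 0 ≤ q.eval x) →
      0 < polyInt ((1 - X ^ 2) ^ 2 * q) := fun q hq h =>
    polyInt_pos (mul_ne_zero (pow_ne_zero _ one_sub_X_sq_ne_zero) hq) fun x hx => by
      rw [eval_mul, eval_pow]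
      exact mul_nonneg (sq_nonneg _) (h x hx)
  rcases h with h | h
  · exact (key p hp h).ne'
  · have := key (-p) (neg_ne_zero.mpr hp) fun x hx => by simpa using h x hx
    rw [mul_neg, map_neg] at this
    linarith

/-- The roots of a quasi-orthogonal polynomial with suitable signs at the end points. -/
theorem roots_of_quasiOrthogonal {f : ℝ[X]} {k : ℕ} (hd : f.natDegree ≤ k + 1)
    (ho : ∀ q : ℝ[X], q.natDegree < k → polyInt ((1 - X ^ 2) ^ 2 * (f * q)) = 0)
    (h1 : 0 < f.eval 1) (h2 : 0 < (-1) ^ (k + 1) * f.eval (-1)) :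
    f.roots.card = k + 1 ∧ f.roots.Nodup ∧ ∀ x ∈ f.roots, x ∈ Set.Ioo (-1 : ℝ) 1 := by
  have hf : f ≠ 0 := by rintro rfl; simp at h1
  obtain ⟨Z, hZ, hs⟩ := exists_finset_roots_sign (k + 1) f hf hd
  have hq : (∏ z ∈ Z, (X - C z)).Monic := monic_prod_X_sub_C _ _
  have hdeg : (∏ z ∈ Z, (X - C z)).natDegree = Z.card := by
    rw [natDegree_prod_of_monic _ _ fun z _ => monic_X_sub_C z]
    simp
  -- With fewer factors, the product of constant sign would have weighted integral zero.
  have hk : k ≤ Z.card := by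
    by_contra! hlt
    exact polyInt_weight_mul_ne_zero (mul_ne_zero hf hq.ne_zero) hs (ho _ (by rwa [hdeg]))
  -- With exactly k factors, the product would be positive at 1 and negative at -1.
  have hk1 : k ≠ Z.card := by
    intro hkZ
    have e1 : 0 < (f * ∏ z ∈ Z, (X - C z)).eval 1 := by
      rw [eval_mul, eval_prod]
      refine mul_pos h1 (Finset.prod_pos fun z hz => ?_)
      have := (hZ z hz).1.2
      simp only [eval_sub, eval_X, eval_C]
      linarith
    have e2 : 0 < -(f * ∏ z ∈ Z, (X - C z)).eval (-1) := by
      have : (∏ z ∈ Z, (X - C z)).eval (-1) = (-1) ^ k * ∏ z ∈ Z, (1 + z) := by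
        rw [hkZ, ← Finset.prod_const, ← Finset.prod_mul_distrib, eval_prod]
        refine Finset.prod_congr rfl fun z _ => ?_
        simp
        ring
      have hpos : 0 < ∏ z ∈ Z, (1 + z) := Finset.prod_pos fun z hz => by linarith [(hZ z hz).1.1]
      rw [eval_mul, this]
      have := mul_pos h2 hpos
      rw [pow_succ] at this
      linarith
    rcases hs with h | h
    · linarith [h (-1) (by norm_num)]
    · linarith [h 1 (by norm_num)]
  have hle : Z.val ≤ f.roots :=
    (Multiset.le_iff_subset Z.nodup).mpr fun z hz => (mem_roots hf).mpr (hZ z hz).2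
  have heq : Z.val = f.roots := by
    refine Multiset.eq_of_le_of_card_le hle ?_
    have := card_roots' f
    have : Multiset.card Z.val = Z.card := rfl
    omega
  have hcard := card_roots' f
  have hle' := Multiset.card_le_card hle
  have hZc : Multiset.card Z.val = Z.card := rfl
  refine ⟨by omega, heq ▸ Z.nodup, fun x hx => ?_⟩
  rw [← heq] at hx
  exact (hZ x hx).1

/-! ### The polynomials R and S, and the zeros of R -/

theorem delta_sq (m : ℕ) : delta (m + 2) ^ 2
    = 3 * ((m : ℝ) + 2) * ((m : ℝ) + 4) * ((m : ℝ) ^ 2 + 6 * (m : ℝ) + 6) := by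
  have e : 3 * ((m + 2 : ℕ) : ℝ) * (((m + 2 : ℕ) : ℝ) + 2)
      * (((m + 2 : ℕ) : ℝ) ^ 2 + 2 * ((m + 2 : ℕ) : ℝ) - 2)
      = 3 * ((m : ℝ) + 2) * ((m : ℝ) + 4) * ((m : ℝ) ^ 2 + 6 * (m : ℝ) + 6) := by
    push_cast
    ring
  rw [delta, Real.sq_sqrt, e]
  rw [e]
  positivity

theorem delta_nonneg (n : ℕ) : 0 ≤ delta n := Real.sqrt_nonneg _

/-- With t = (m + 3)², δ² = 3(t - 1)(t - 3) ≤ 4t². The bound fixes the sign of R at -1. -/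
theorem delta_le (m : ℕ) : delta (m + 2) ≤ 2 * ((m : ℝ) + 3) ^ 2 := by
  refine le_of_sq_le_sq ?_ (by positivity)
  rw [delta_sq]
  have : (0 : ℝ) ≤ m := Nat.cast_nonneg m
  nlinarith [pow_nonneg this 2, pow_nonneg this 3, pow_nonneg this 4]

/-- The coefficient of `C_{n-1}` in `R_{n-1}`, for `n = m + 2`. -/
def coefA (m : ℕ) : ℝ := ((m : ℝ) + 1) * (2 * (m : ℝ) ^ 2 + 10 * (m : ℝ) + 9)

/-- The coefficient of `C_{n-2}` in `R_{n-1}`, for `n = m + 2`. -/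
def coefB (m : ℕ) : ℝ :=
  2 * delta (m + 2) - (2 * (m : ℝ) ^ 3 + 18 * (m : ℝ) ^ 2 + 49 * (m : ℝ) + 39)

theorem coefA_pos (m : ℕ) : 0 < coefA m := by unfold coefA; positivity

theorem polyR_eq (m : ℕ) : polyR (m + 2) = C (coefA m) * geg (m + 1) + C (coefB m) * geg m := by
  have e1 : ((m + 2 : ℕ) : ℤ) - 1 = Int.ofNat (m + 1) := by push_cast; simp; ring
  have e2 : ((m + 2 : ℕ) : ℤ) - 2 = Int.ofNat m := by push_cast; simp
  rw [polyR, e1, e2]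
  simp only [geg52, geg, coefA, coefB]
  congr 3
  · push_cast; ring
  · push_cast; ring

/-- The convention C_{-1} = 0 keeps the recurrence valid at m = 0, which covers n = 2 in S_{n-2}. -/
theorem geg52_rec (m : ℕ) :
    ((m : ℝ[X]) + 4) * geg52 ((m : ℤ) - 1)
      = (2 * (m : ℝ[X]) + 5) * X * geg m - ((m : ℝ[X]) + 1) * geg (m + 1) := by
  cases m with
  | zero =>
    have : ((0 : ℕ) : ℤ) - 1 = Int.negSucc 0 := rfl
    rw [this, zero_add, geg_zero, geg_one]
    simp [geg52]
  | succ m =>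
    have : ((m + 1 : ℕ) : ℤ) - 1 = Int.ofNat m := by simp
    rw [this]
    have h := geg_rec m
    simp only [geg52]
    push_cast
    linear_combination h

/-- Modulo `R_{n-1}`, the polynomial `S_{n-2}` is a multiple of `(1 + x) C_{n-2}`. -/
theorem polyS_eq (m : ℕ) : polyS (m + 2)
    = C ((2 * (m : ℝ) + 5) * (2 * (m : ℝ) ^ 2 + 10 * (m : ℝ) + 9)) * (1 + X) * geg m
      - polyR (m + 2) := by
  have e2 : ((m + 2 : ℕ) : ℤ) - 2 = Int.ofNat m := by push_cast; simp
  have e3 : ((m + 2 : ℕ) : ℤ) - 3 = (m : ℤ) - 1 := by push_cast; ring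
  have h := geg52_rec m
  rw [polyR_eq, polyS, e2, e3]
  refine Polynomial.funext fun x => ?_
  have hx := congrArg (eval x) h
  simp only [geg52, eval_add, eval_sub, eval_mul, eval_C, eval_X, eval_one, eval_natCast,
    eval_ofNat, coefA, coefB] at hx ⊢
  push_cast
  linear_combination (2 * (m : ℝ) ^ 2 + 10 * (m : ℝ) + 9) * hx

/-- An antiderivative of `R_{n-1}`, for `n = m + 2`. -/
def polyRF (m : ℕ) : ℝ[X] := C (coefA m) * gegF (m + 1) + C (coefB m) * gegF m

/-- A second antiderivative of `R_{n-1}`, for `n = m + 2`. -/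
def polyRE (m : ℕ) : ℝ[X] := C (coefA m) * gegE (m + 1) + C (coefB m) * gegE m

theorem polyInt_polyR_mul {m : ℕ} {q : ℝ[X]} (hq : q.natDegree ≤ m + 3) :
    polyInt (polyR (m + 2) * q)
      = (polyRF m * q - polyRE m * derivative q).eval 1
        - (polyRF m * q - polyRE m * derivative q).eval (-1) := by
  rw [polyR_eq, add_mul, map_add, mul_assoc, mul_assoc, polyInt_C_mul, polyInt_C_mul,
    polyInt_geg_mul hq, polyInt_geg_mul (m := m + 1) (by omega), polyRF, polyRE]
  simp only [eval_add, eval_sub, eval_mul, eval_C]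
  ring

theorem weightInt_polyR {m : ℕ} {q : ℝ[X]} (hq : q.natDegree < m) :
    polyInt ((1 - X ^ 2) ^ 2 * (polyR (m + 2) * q)) = 0 := by
  have e : (1 - X ^ 2) ^ 2 * (polyR (m + 2) * q)
      = C (coefA m) * ((1 - X ^ 2) ^ 2 * geg (m + 1) * q)
        + C (coefB m) * ((1 - X ^ 2) ^ 2 * geg m * q) := by
    rw [polyR_eq]
    ring
  rw [e, map_add, polyInt_C_mul, polyInt_C_mul, ← weightInt_apply, ← weightInt_apply,
    weightInt_geg_eq_zero hq, weightInt_geg_eq_zero (hq.trans (Nat.lt_succ_self m))]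
  simp

theorem polyR_eval_one (m : ℕ) : (polyR (m + 2)).eval 1
    = ((m : ℝ) + 1) * ((m : ℝ) + 2) * ((m : ℝ) + 3) * ((m : ℝ) + 4) / 12
      * (delta (m + 2) + (m : ℝ) ^ 2 + 5 * (m : ℝ) + 3) := by
  rw [polyR_eq]
  simp only [eval_add, eval_mul, eval_C, geg_eval_one, coefA, coefB]
  push_cast
  ring

theorem polyR_eval_neg_one (m : ℕ) : (polyR (m + 2)).eval (-1)
    = (-1) ^ m * (((m : ℝ) + 1) * ((m : ℝ) + 2) * ((m : ℝ) + 3) * ((m : ℝ) + 4) / 12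
      * (delta (m + 2) - (2 * (m : ℝ) ^ 3 + 19 * (m : ℝ) ^ 2 + 54 * (m : ℝ) + 42))) := by
  rw [polyR_eq]
  simp only [eval_add, eval_mul, eval_C, geg_eval_neg_one, coefA, coefB, pow_succ]
  push_cast
  ring

theorem polyR_derivative_eval_one (m : ℕ) : (derivative (polyR (m + 2))).eval 1
    = ((m : ℝ) + 1) * ((m : ℝ) + 2) * ((m : ℝ) + 3) * ((m : ℝ) + 4) / 144
      * ((2 * (m : ℝ) ^ 2 + 10 * (m : ℝ) + 9) * ((m : ℝ) + 5) * ((m : ℝ) + 1) * ((m : ℝ) + 6)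
        + coefB m * m * ((m : ℝ) + 5)) := by
  rw [polyR_eq]
  simp only [derivative_add, derivative_C_mul, eval_add, eval_mul, eval_C, geg_derivative_eval_one,
    geg_eval_one, coefA]
  push_cast
  ring

theorem polyR_derivative_eval_neg_one (m : ℕ) : (derivative (polyR (m + 2))).eval (-1)
    = (-1) ^ m * (((m : ℝ) + 1) * ((m : ℝ) + 2) * ((m : ℝ) + 3) * ((m : ℝ) + 4) / 144
      * ((2 * (m : ℝ) ^ 2 + 10 * (m : ℝ) + 9) * ((m : ℝ) + 5) * ((m : ℝ) + 1) * ((m : ℝ) + 6)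
        - coefB m * m * ((m : ℝ) + 5))) := by
  rw [polyR_eq]
  simp only [derivative_add, derivative_C_mul, eval_add, eval_mul, eval_C,
    geg_derivative_eval_neg_one, geg_eval_neg_one, coefA, pow_succ]
  push_cast
  ring

theorem polyRF_eval_one (m : ℕ) : (polyRF m).eval 1
    = (coefA m * (((m : ℝ) + 3) * ((m : ℝ) + 4)) + coefB m * (((m : ℝ) + 2) * ((m : ℝ) + 3))) / 6 := by
  simp only [polyRF, eval_add, eval_mul, eval_C, gegF_eval_one]
  push_cast
  ring

theorem polyRF_eval_neg_one (m : ℕ) : (polyRF m).eval (-1)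
    = (-1) ^ m * ((coefA m * (((m : ℝ) + 3) * ((m : ℝ) + 4))
      - coefB m * (((m : ℝ) + 2) * ((m : ℝ) + 3))) / 6) := by
  simp only [polyRF, eval_add, eval_mul, eval_C, gegF_eval_neg_one, pow_succ]
  push_cast
  ring

theorem polyRE_eval_one (m : ℕ) : (polyRE m).eval 1 = (coefA m + coefB m) / 3 := by
  simp only [polyRE, eval_add, eval_mul, eval_C, gegE_eval_one]
  ring

theorem polyRE_eval_neg_one (m : ℕ) :
    (polyRE m).eval (-1) = (-1) ^ m * ((coefB m - coefA m) / 3) := by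
  simp only [polyRE, eval_add, eval_mul, eval_C, gegE_eval_neg_one, pow_succ]
  ring

theorem polyR_eval_one_pos (m : ℕ) : 0 < (polyR (m + 2)).eval 1 := by
  have := delta_nonneg (m + 2)
  rw [polyR_eval_one]
  positivity

theorem polyR_eval_neg_one_pos (m : ℕ) : 0 < (-1) ^ (m + 1) * (polyR (m + 2)).eval (-1) := by
  have h := delta_le m
  have hm : (0 : ℝ) ≤ m := Nat.cast_nonneg m
  have h2 : 0 < 2 * (m : ℝ) ^ 3 + 19 * (m : ℝ) ^ 2 + 54 * (m : ℝ) + 42 - delta (m + 2) := by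
    nlinarith [pow_nonneg hm 2, pow_nonneg hm 3]
  have e : (-1 : ℝ) ^ (m + 1) * (polyR (m + 2)).eval (-1)
      = ((m : ℝ) + 1) * ((m : ℝ) + 2) * ((m : ℝ) + 3) * ((m : ℝ) + 4) / 12
      * (2 * (m : ℝ) ^ 3 + 19 * (m : ℝ) ^ 2 + 54 * (m : ℝ) + 42 - delta (m + 2)) := by
    have hs : (-1 : ℝ) ^ m * (-1) ^ m = 1 := by rw [← mul_pow]; simp
    rw [polyR_eval_neg_one, pow_succ]
    linear_combination (-(((m : ℝ) + 1) * ((m : ℝ) + 2) * ((m : ℝ) + 3) * ((m : ℝ) + 4) / 12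
      * (delta (m + 2) - (2 * (m : ℝ) ^ 3 + 19 * (m : ℝ) ^ 2 + 54 * (m : ℝ) + 42)))) * hs
  rw [e]
  positivity

theorem polyR_eval_neg_one_ne_zero (m : ℕ) : (polyR (m + 2)).eval (-1) ≠ 0 :=
  right_ne_zero_of_mul (polyR_eval_neg_one_pos m).ne'

theorem polyR_ne_zero (m : ℕ) : polyR (m + 2) ≠ 0 := by
  intro h
  have := polyR_eval_one_pos m
  simp [h] at this

theorem natDegree_polyR_le (m : ℕ) : (polyR (m + 2)).natDegree ≤ m + 1 := by
  rw [polyR_eq]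
  have h1 := natDegree_geg_le (m + 1)
  have h2 := natDegree_geg_le m
  compute_degree
  omega

theorem polyR_roots (m : ℕ) : (polyR (m + 2)).roots.card = m + 1 ∧ (polyR (m + 2)).roots.Nodup ∧
    ∀ x ∈ (polyR (m + 2)).roots, x ∈ Set.Ioo (-1 : ℝ) 1 :=
  roots_of_quasiOrthogonal (natDegree_polyR_le m) (fun _ hq => weightInt_polyR hq)
    (polyR_eval_one_pos m) (polyR_eval_neg_one_pos m)

theorem natDegree_polyR (m : ℕ) : (polyR (m + 2)).natDegree = m + 1 :=
  le_antisymm (natDegree_polyR_le m) ((polyR_roots m).1 ▸ card_roots' _)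

/-! ### Boundary terms of the one-interval rule -/

/-- The choice of `δ` makes the value at `1` drop out of the one-interval rule. -/
theorem polyR_boundary_one (m : ℕ) :
    (polyRF m).eval 1 * (polyR (m + 2)).eval 1
      + (polyRE m).eval 1 * (derivative (polyR (m + 2))).eval 1 = 0 := by
  rw [polyRF_eval_one, polyRE_eval_one, polyR_derivative_eval_one, polyR_eval_one]
  simp only [coefA, coefB]
  -- The left side is this factor times δ² - 3n(n+2)(n²+2n-2), whence the value of δ.
  linear_combination (((m : ℝ) + 1) * ((m : ℝ) + 2) * ((m : ℝ) + 3) * ((m : ℝ) + 4)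
    * (2 * (m : ℝ) ^ 2 + 10 * m + 9) / 54) * delta_sq m

theorem endWeight_eq (m : ℕ) : endWeight (m + 2)
    = 8 * (2 * (m : ℝ) ^ 2 + 12 * m + 13)
      * (2 * (m : ℝ) ^ 4 + 24 * (m : ℝ) ^ 3 + 100 * (m : ℝ) ^ 2 + 168 * m + 93 - delta (m + 2))
      / (3 * ((m : ℝ) + 1) * ((m : ℝ) + 2) * ((m : ℝ) + 4) * ((m : ℝ) + 5)
        * ((m : ℝ) ^ 2 + 6 * m + 6) * ((m : ℝ) + 3) ^ 2) := by
  rw [endWeight]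
  push_cast
  congr 1 <;> ring

/-- This equation determines w_1: the value at -1 must enter the one-interval rule with weight
w_1/2. -/
theorem polyR_boundary_neg_one (m : ℕ) :
    (polyRF m).eval (-1) * (polyR (m + 2)).eval (-1)
      + endWeight (m + 2) / 2 * (polyR (m + 2)).eval (-1) ^ 2
      + (polyRE m).eval (-1) * (derivative (polyR (m + 2))).eval (-1) = 0 := by
  have h1 : (m : ℝ) + 1 ≠ 0 := by positivity
  have h2 : (m : ℝ) + 2 ≠ 0 := by positivity
  have h3 : (m : ℝ) + 3 ≠ 0 := by positivity
  have h4 : (m : ℝ) + 4 ≠ 0 := by positivity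
  have h5 : (m : ℝ) + 5 ≠ 0 := by positivity
  have h6 : (m : ℝ) ^ 2 + 6 * m + 6 ≠ 0 := by positivity
  have hw : endWeight (m + 2) * (((m : ℝ) + 1) * ((m : ℝ) + 2) * ((m : ℝ) + 3) * ((m : ℝ) + 4))
      * (3 * (((m : ℝ) + 5) * ((m : ℝ) + 3) * ((m : ℝ) ^ 2 + 6 * m + 6)))
      = 8 * (2 * (m : ℝ) ^ 2 + 12 * m + 13)
      * (2 * (m : ℝ) ^ 4 + 24 * (m : ℝ) ^ 3 + 100 * (m : ℝ) ^ 2 + 168 * m + 93 - delta (m + 2)) := by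
    rw [endWeight_eq]
    field_simp
  apply mul_left_cancel₀ (mul_ne_zero (mul_ne_zero h5 h3) h6)
  rw [polyRF_eval_neg_one, polyRE_eval_neg_one, polyR_derivative_eval_neg_one, polyR_eval_neg_one]
  simp only [coefA, coefB]
  have hd := delta_sq m
  generalize delta (m + 2) = d at *
  -- Every term carries ε², so the parity of m plays no role.
  generalize (-1 : ℝ) ^ m = ε at *
  generalize (m : ℝ) = t at *
  linear_combination (ε ^ 2 * ((t + 1) * (t + 2) * (t + 3) * (t + 4)) / 864
      * (d - (2 * t ^ 3 + 19 * t ^ 2 + 54 * t + 42)) ^ 2) * hw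
    + ε ^ 2 * ((t + 1) * (t + 2) * (t + 3) * (t + 4)) *
      (-((2 * t ^ 2 + 10 * t + 9) * ((t + 5) * (t + 3) * (t ^ 2 + 6 * t + 6))) / 54
      + (2 * t ^ 2 + 12 * t + 13) * ((2 * t ^ 4 + 24 * t ^ 3 + 100 * t ^ 2 + 168 * t + 93)
        + 2 * (2 * t ^ 3 + 19 * t ^ 2 + 54 * t + 42) - d) / 108) * hd

/-- The coefficient of the derivative at `-1` in the one-interval rule. -/
def derivWeightLeft (m : ℕ) : ℝ := (polyRE m).eval (-1) / (polyR (m + 2)).eval (-1)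

/-- The coefficient of the derivative at `1` in the one-interval rule. -/
def derivWeightRight (m : ℕ) : ℝ := -((polyRE m).eval 1 / (polyR (m + 2)).eval 1)

/-- The integral minus the boundary terms of the one-interval rule. -/
def interiorPart (m : ℕ) : ℝ[X] →ₗ[ℝ] ℝ :=
  polyInt - (endWeight (m + 2) / 2) • leval (-1)
    - derivWeightLeft m • (leval (-1) ∘ₗ derivative)
    - derivWeightRight m • (leval 1 ∘ₗ derivative)

theorem interiorPart_apply (m : ℕ) (p : ℝ[X]) : interiorPart m p
    = polyInt p - endWeight (m + 2) / 2 * p.eval (-1)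
      - derivWeightLeft m * (derivative p).eval (-1)
      - derivWeightRight m * (derivative p).eval 1 := by
  simp [interiorPart, leval]

/-- Compare the coefficients of q(±1) and q'(±1): `e1` and `e2` are the choice of the derivative
weights, `e3` and `e4` the two boundary identities. -/
theorem interiorPart_polyR_mul {m : ℕ} {q : ℝ[X]} (hq : q.natDegree ≤ m + 3) :
    interiorPart m (polyR (m + 2) * q) = 0 := by
  have h1 := (polyR_eval_one_pos m).ne'
  have h2 := polyR_eval_neg_one_ne_zero m
  have e1 : derivWeightRight m * (polyR (m + 2)).eval 1 = -(polyRE m).eval 1 := by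
    rw [derivWeightRight]; field_simp
  have e2 : derivWeightLeft m * (polyR (m + 2)).eval (-1) = (polyRE m).eval (-1) := by
    rw [derivWeightLeft]; field_simp
  have e3 : derivWeightRight m * (derivative (polyR (m + 2))).eval 1 = (polyRF m).eval 1 := by
    apply mul_left_cancel₀ h1
    linear_combination (derivative (polyR (m + 2))).eval 1 * e1 - polyR_boundary_one m
  have e4 : endWeight (m + 2) / 2 * (polyR (m + 2)).eval (-1)
      + derivWeightLeft m * (derivative (polyR (m + 2))).eval (-1) = -(polyRF m).eval (-1) := by
    apply mul_left_cancel₀ h2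
    linear_combination (derivative (polyR (m + 2))).eval (-1) * e2 + polyR_boundary_neg_one m
  rw [interiorPart_apply, polyInt_polyR_mul hq]
  simp only [derivative_mul, eval_add, eval_sub, eval_mul]
  linear_combination (-q.eval (-1)) * e4 - (derivative q).eval (-1) * e2 - q.eval 1 * e3
    - (derivative q).eval 1 * e1

/-! ### Christoffel numbers -/

theorem polyR_factor {m : ℕ} {x : ℝ} (hx : (polyR (m + 2)).eval x = 0) :
    (X - C x) * (polyR (m + 2) /ₘ (X - C x)) = polyR (m + 2) :=
  mul_divByMonic_eq_iff_isRoot.mpr hx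

theorem polyR_quotient_eval_self {m : ℕ} {x : ℝ} (hx : (polyR (m + 2)).eval x = 0) :
    (polyR (m + 2) /ₘ (X - C x)).eval x = (derivative (polyR (m + 2))).eval x := by
  conv_rhs => rw [← polyR_factor hx]
  simp

theorem polyR_quotient_eval_of_ne {m : ℕ} {x y : ℝ} (hx : (polyR (m + 2)).eval x = 0)
    (hy : (polyR (m + 2)).eval y = 0) (hxy : y ≠ x) :
    (polyR (m + 2) /ₘ (X - C x)).eval y = 0 := by
  rw [← polyR_factor hx, eval_mul] at hy
  simpa [sub_eq_zero, hxy] using hy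

theorem natDegree_polyR_quotient (m : ℕ) (x : ℝ) :
    (polyR (m + 2) /ₘ (X - C x)).natDegree = m := by
  rw [natDegree_divByMonic _ (monic_X_sub_C x), natDegree_polyR, natDegree_X_sub_C]
  rfl

theorem coeff_polyR_quotient {m : ℕ} {x : ℝ} (hx : (polyR (m + 2)).eval x = 0) :
    (polyR (m + 2) /ₘ (X - C x)).coeff m = coefA m * (geg (m + 1)).coeff (m + 1) := by
  have h := congrArg (fun p => coeff p (m + 1)) (polyR_factor hx)
  have h0 : (geg m).coeff (m + 1) = 0 :=
    coeff_eq_zero_of_natDegree_lt (Nat.lt_succ_of_le (natDegree_geg_le m))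
  have h1 : (polyR (m + 2) /ₘ (X - C x)).coeff (m + 1) = 0 :=
    coeff_eq_zero_of_natDegree_lt (by rw [natDegree_polyR_quotient]; omega)
  simp only [sub_mul, coeff_sub, coeff_X_mul, coeff_C_mul, h1, mul_zero, sub_zero] at h
  rw [h, polyR_eq]
  simp [h0]

theorem natDegree_weight_mul_geg_le (m : ℕ) : ((1 - X ^ 2) ^ 2 * geg m).natDegree ≤ m + 4 := by
  have := natDegree_geg_le m
  compute_degree
  omega

theorem derivative_weight_mul_eval (q : ℝ[X]) {x : ℝ} (hx : x ^ 2 = 1) :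
    (derivative ((1 - X ^ 2) ^ 2 * q)).eval x = 0 := by
  simp [derivative_mul, derivative_pow, hx]

theorem interiorPart_weight_mul (m : ℕ) (q : ℝ[X]) :
    interiorPart m ((1 - X ^ 2) ^ 2 * q) = polyInt ((1 - X ^ 2) ^ 2 * q) := by
  rw [interiorPart_apply, derivative_weight_mul_eval _ (by norm_num),
    derivative_weight_mul_eval _ (by norm_num)]
  simp

/-- Evaluate the functional at q g, with g = R/(X - x) and q = (1 - X²)² C_m, in two ways. Modulo R
the product is q(x) g, the cofactor of R having degree at most m + 3. On the other hand q kills the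
boundary terms, and by orthogonality only the leading coefficient of g survives. -/
theorem interiorPart_polyR_quotient {m : ℕ} {x : ℝ} (hx : (polyR (m + 2)).eval x = 0) :
    (1 - x ^ 2) ^ 2 * (geg m).eval x * interiorPart m (polyR (m + 2) /ₘ (X - C x))
      = coefA m * (2 / 9 * ((m : ℝ) + 2) * ((m : ℝ) + 3) * ((m : ℝ) + 4)) := by
  set g := polyR (m + 2) /ₘ (X - C x) with hg
  set q := (1 - X ^ 2) ^ 2 * geg m with hq
  have h0 : (X - C x) * (q /ₘ (X - C x)) = q - C (q.eval x) := by
    have := modByMonic_add_div q (X - C x)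
    rw [modByMonic_X_sub_C_eq_C_eval] at this
    linear_combination this
  have h1 : q * g = C (q.eval x) * g + polyR (m + 2) * (q /ₘ (X - C x)) := by
    rw [← polyR_factor hx, ← hg]
    linear_combination -g * h0
  have h2 : interiorPart m (q * g) = q.eval x * interiorPart m g := by
    rw [h1, map_add, interiorPart_polyR_mul, add_zero, ← smul_eq_C_mul, map_smul, smul_eq_mul]
    rw [natDegree_divByMonic _ (monic_X_sub_C x), natDegree_X_sub_C]
    have := natDegree_weight_mul_geg_le m
    rw [← hq] at this
    omega
  have h3 : interiorPart m (q * g) = weightInt (geg m) g := by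
    rw [hq, mul_assoc, interiorPart_weight_mul, weightInt_apply, mul_assoc]
  rw [weightInt_geg_eq_coeff (natDegree_polyR_quotient m x).le, coeff_polyR_quotient hx,
    mul_assoc (coefA m),
    coeff_geg_mul_weightInt, h2] at h3
  rw [← h3, hq]
  simp

/-- C_m(x) is a factor of the left side of the preceding identity, whose right side is positive. -/
theorem geg_eval_ne_zero {m : ℕ} {x : ℝ} (hx : (polyR (m + 2)).eval x = 0) :
    (geg m).eval x ≠ 0 := by
  intro h
  have h1 := interiorPart_polyR_quotient hx
  rw [h, mul_zero, zero_mul] at h1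
  have := coefA_pos m
  have : 0 < coefA m * (2 / 9 * ((m : ℝ) + 2) * ((m : ℝ) + 3) * ((m : ℝ) + 4)) := by positivity
  linarith

theorem polyS_eval {m : ℕ} {x : ℝ} (hx : (polyR (m + 2)).eval x = 0) :
    (polyS (m + 2)).eval x = (2 * (m : ℝ) + 5) * (2 * (m : ℝ) ^ 2 + 10 * (m : ℝ) + 9) * (1 + x)
      * (geg m).eval x := by
  rw [polyS_eq, eval_sub, hx]
  simp only [eval_mul, eval_C, eval_add, eval_one, eval_X, sub_zero]

theorem polyR_derivative_ne_zero {m : ℕ} {x : ℝ} (hx : (polyR (m + 2)).eval x = 0) :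
    (derivative (polyR (m + 2))).eval x ≠ 0 := by
  intro h
  have h1 := (one_lt_rootMultiplicity_iff_isRoot (polyR_ne_zero m)).mpr ⟨hx, h⟩
  have h2 := Multiset.nodup_iff_count_le_one.mp (polyR_roots m).2.1 x
  rw [count_roots] at h2
  omega

theorem mem_Ioo_of_root {m : ℕ} {x : ℝ} (hx : (polyR (m + 2)).eval x = 0) :
    x ∈ Set.Ioo (-1 : ℝ) 1 :=
  (polyR_roots m).2.2 x ((mem_roots (polyR_ne_zero m)).mpr hx)

theorem polyS_ne_zero {m : ℕ} {x : ℝ} (hx : (polyR (m + 2)).eval x = 0) :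
    (polyS (m + 2)).eval x ≠ 0 := by
  have h1 : 0 < 1 + x := by linarith [(mem_Ioo_of_root hx).1]
  have h2 : 0 < (2 * (m : ℝ) + 5) * (2 * (m : ℝ) ^ 2 + 10 * (m : ℝ) + 9) := by positivity
  rw [polyS_eval hx]
  exact mul_ne_zero (mul_pos h2 h1).ne' (geg_eval_ne_zero hx)

/-- The interior weights are the Christoffel numbers of the rule. -/
theorem interiorWeight_eq {m : ℕ} {x : ℝ} (hx : (polyR (m + 2)).eval x = 0) :
    interiorWeight (m + 2) x
      = interiorPart m (polyR (m + 2) /ₘ (X - C x)) / (derivative (polyR (m + 2))).eval x := by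
  have h := interiorPart_polyR_quotient hx
  have hg := geg_eval_ne_zero hx
  have hd := polyR_derivative_ne_zero hx
  have h1 : 1 + x ≠ 0 := by linarith [(mem_Ioo_of_root hx).1]
  have h2 : 1 - x ≠ 0 := by linarith [(mem_Ioo_of_root hx).2]
  have h3 : (2 * (m : ℝ) + 5) ≠ 0 := by positivity
  have h4 : (2 * (m : ℝ) ^ 2 + 10 * (m : ℝ) + 9) ≠ 0 := by positivity
  rw [interiorWeight, polyS_eval hx, constA]
  rw [div_eq_div_iff (by simp [*]) hd]
  rw [coefA] at h
  push_cast
  linear_combination (-((2 * (m : ℝ) + 5) * (2 * (m : ℝ) ^ 2 + 10 * (m : ℝ) + 9)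
    * (derivative (polyR (m + 2))).eval x)) * h

/-! ### The one-interval rule and its transport -/

/-- A polynomial vanishing at the roots of `R_{n-1}` is a multiple of `R_{n-1}`. -/
theorem polyR_dvd {m : ℕ} {p : ℝ[X]} (h : ∀ x, (polyR (m + 2)).eval x = 0 → p.eval x = 0) :
    polyR (m + 2) ∣ p := by
  rcases eq_or_ne p 0 with rfl | hp
  · exact dvd_zero _
  obtain ⟨hc, hn, -⟩ := polyR_roots m
  have hle : (polyR (m + 2)).roots ≤ p.roots :=
    (Multiset.le_iff_subset hn).mpr fun x hx =>
      (mem_roots hp).mpr (h x ((mem_roots (polyR_ne_zero m)).mp hx))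
  have hd := (Multiset.prod_X_sub_C_dvd_iff_le_roots hp _).mpr hle
  have hR := C_leadingCoeff_mul_prod_multiset_X_sub_C (hc.trans (natDegree_polyR m).symm)
  rw [← hR]
  have hu : IsUnit (C (polyR (m + 2)).leadingCoeff) :=
    isUnit_C.mpr (leadingCoeff_ne_zero.mpr (polyR_ne_zero m)).isUnit
  exact (hu.mul_left_dvd).mpr hd

theorem mem_nodes {m : ℕ} {x : ℝ} :
    x ∈ (polyR (m + 2)).roots.toFinset ↔ (polyR (m + 2)).eval x = 0 := by
  rw [Multiset.mem_toFinset, mem_roots (polyR_ne_zero m)]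
  rfl

/-- The one-interval rule with derivatives at the end points. -/
theorem polyInt_eq_rule {m : ℕ} {p : ℝ[X]} (hp : p.natDegree ≤ 2 * m + 4) :
    polyInt p = endWeight (m + 2) / 2 * p.eval (-1) + derivWeightLeft m * (derivative p).eval (-1)
      + derivWeightRight m * (derivative p).eval 1
      + ∑ x ∈ (polyR (m + 2)).roots.toFinset, interiorWeight (m + 2) x * p.eval x := by
  set Z := (polyR (m + 2)).roots.toFinset with hZ
  -- The Lagrange interpolant of p at the zeros of R. Then p - r = R q with deg q ≤ m + 3, which the
  -- functional annihilates.
  set r : ℝ[X] := ∑ x ∈ Z, C (p.eval x / (derivative (polyR (m + 2))).eval x)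
    * (polyR (m + 2) /ₘ (X - C x)) with hr
  have hev : ∀ y, (polyR (m + 2)).eval y = 0 → (p - r).eval y = 0 := by
    intro y hy
    rw [hr, eval_sub, eval_finsetSum, Finset.sum_eq_single y]
    · rw [eval_mul, eval_C, polyR_quotient_eval_self hy,
        div_mul_cancel₀ _ (polyR_derivative_ne_zero hy), sub_self]
    · intro x hx hxy
      rw [eval_mul, polyR_quotient_eval_of_ne (mem_nodes.mp hx) hy hxy.symm, mul_zero]
    · intro h
      exact absurd (mem_nodes.mpr hy) h
  obtain ⟨q, hq⟩ := polyR_dvd hev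
  have hrd : r.natDegree ≤ m := by
    refine natDegree_sum_le_of_forall_le _ _ fun x _ => ?_
    exact (natDegree_C_mul_le _ _).trans (natDegree_polyR_quotient m x).le
  have hqd : q.natDegree ≤ m + 3 := by
    rcases eq_or_ne q 0 with rfl | hq0
    · simp
    have h1 := natDegree_sub_le p r
    rw [hq, natDegree_mul (polyR_ne_zero m) hq0, natDegree_polyR] at h1
    have : max p.natDegree r.natDegree ≤ 2 * m + 4 := max_le hp (by omega)
    omega
  have h0 : interiorPart m p = ∑ x ∈ Z, interiorWeight (m + 2) x * p.eval x := by
    have h1 : interiorPart m (p - r) = 0 := by rw [hq, interiorPart_polyR_mul hqd]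
    rw [map_sub, sub_eq_zero] at h1
    rw [h1, hr, map_sum]
    refine Finset.sum_congr rfl fun x hx => ?_
    rw [← smul_eq_C_mul, map_smul, smul_eq_mul, interiorWeight_eq (mem_nodes.mp hx)]
    ring
  rw [← h0, interiorPart_apply]
  ring

theorem card_nodes (m : ℕ) : (polyR (m + 2)).roots.toFinset.card = m + 1 := by
  rw [Multiset.toFinset_card_of_nodup (polyR_roots m).2.1, (polyR_roots m).1]

theorem neg_one_notMem_nodes (m : ℕ) : (-1 : ℝ) ∉ (polyR (m + 2)).roots.toFinset := fun h =>
  lt_irrefl _ (mem_Ioo_of_root (mem_nodes.mp h)).1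

theorem card_first (m : ℕ) : (first (m + 2)).nodes.card = m + 2 := by
  rw [first, Finset.card_insert_of_notMem (neg_one_notMem_nodes m), card_nodes]

theorem card_second (m : ℕ) : (second (m + 2)).nodes.card = m + 1 := by
  rw [second, Finset.card_image_of_injective _ neg_injective, card_nodes]

theorem integral_eq_mul_polyInt_comp (p : ℝ[X]) (c d : ℝ) :
    ∫ x in (d - c)..(d + c), p.eval x = c * polyInt (p.comp (C c * X + C d)) := by
  have h := intervalIntegral.smul_integral_comp_mul_add (a := -1) (b := 1)
    (fun x => p.eval x) c d
  have e1 : c * -1 + d = d - c := by ring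
  have e2 : c * 1 + d = d + c := by ring
  rw [e1, e2, smul_eq_mul] at h
  rw [← h, polyInt_apply]
  simp

theorem natDegree_comp_affine_le (p : ℝ[X]) (c d : ℝ) :
    (p.comp (C c * X + C d)).natDegree ≤ p.natDegree := by
  simpa using natDegree_comp_le.trans
    (Nat.mul_le_mul_left p.natDegree (natDegree_linear_le (a := c) (b := d)))

theorem derivative_comp_affine_eval (p : ℝ[X]) (c d x : ℝ) :
    (derivative (p.comp (C c * X + C d))).eval x = c * (derivative p).eval (c * x + d) := by
  rw [derivative_comp]
  simp

/-- The one-interval rule, transported by an affine map. -/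
theorem integral_eq_rule {m : ℕ} {p : ℝ[X]} (hp : p.natDegree ≤ 2 * m + 4) (c d : ℝ) :
    ∫ x in (d - c)..(d + c), p.eval x
      = c * (endWeight (m + 2) / 2 * p.eval (d - c)
        + derivWeightLeft m * (c * (derivative p).eval (d - c))
        + derivWeightRight m * (c * (derivative p).eval (d + c))
        + ∑ x ∈ (polyR (m + 2)).roots.toFinset, interiorWeight (m + 2) x * p.eval (c * x + d)) := by
  have e1 : c * -1 + d = d - c := by ring
  have e2 : c * 1 + d = d + c := by ring
  rw [integral_eq_mul_polyInt_comp, polyInt_eq_rule ((natDegree_comp_affine_le p c d).trans hp),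
    derivative_comp_affine_eval, derivative_comp_affine_eval, e1, e2]
  simp only [eval_comp, eval_add, eval_mul, eval_C, eval_X, e1]

theorem deriv_eq_of_eqOn_Icc {s : ℝ → ℝ} (hs : ContDiff ℝ 1 s) {p : ℝ[X]} {a b : ℝ} (hab : a < b)
    (h : ∀ x ∈ Set.Icc a b, s x = p.eval x) {x : ℝ} (hx : x ∈ Set.Icc a b) :
    deriv s x = (derivative p).eval x := by
  have h1 : HasDerivWithinAt s (deriv s x) (Set.Icc a b) x :=
    ((hs.differentiable one_ne_zero) x).hasDerivAt.hasDerivWithinAt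
  have h2 : HasDerivWithinAt s ((derivative p).eval x) (Set.Icc a b) x :=
    (p.hasDerivAt x).hasDerivWithinAt.congr h (h x hx)
  exact (uniqueDiffOn_Icc hab x hx).eq_deriv _ h1 h2

theorem integral_congr_Icc {s : ℝ → ℝ} {p : ℝ[X]} {a b : ℝ} (hab : a ≤ b)
    (h : ∀ x ∈ Set.Icc a b, s x = p.eval x) : ∫ x in a..b, s x = ∫ x in a..b, p.eval x :=
  intervalIntegral.integral_congr fun x hx => h x (by rwa [Set.uIcc_of_le hab] at hx)

section Pieces

variable {m : ℕ} {s : ℝ → ℝ} {p : ℝ[X]} {u v h : ℝ}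

/-- The node -1 has the full weight w_1 here but w_1/2 in the one-interval rule; the surplus at u is
the share of the preceding reflected interval. -/
theorem sumOn_first (hs : ContDiff ℝ 1 s) (hp : p.natDegree ≤ 2 * m + 4) (hh : 0 < h)
    (huv : v = u + h) (hsp : ∀ x ∈ Set.Icc u v, s x = p.eval x) :
    (first (m + 2)).sumOn u h s = (∫ x in u..v, s x)
      + h / 2 * (endWeight (m + 2) / 2 * s u - h / 2 * (derivWeightLeft m * deriv s u))
      - (h / 2) ^ 2 * (derivWeightRight m * deriv s v) := by
  have huv' : u < v := by linarith
  have hu : u ∈ Set.Icc u v := ⟨le_rfl, huv'.le⟩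
  have hv : v ∈ Set.Icc u v := ⟨huv'.le, le_rfl⟩
  have hr := integral_eq_rule hp (h / 2) (u + h / 2)
  have e1 : u + h / 2 - h / 2 = u := by ring
  have e2 : u + h / 2 + h / 2 = v := by rw [huv]; ring
  have hsum : ∑ x ∈ (polyR (m + 2)).roots.toFinset,
      h / 2 * (first (m + 2)).weight x * s (u + h * (x + 1) / 2)
      = h / 2 * ∑ x ∈ (polyR (m + 2)).roots.toFinset,
        interiorWeight (m + 2) x * p.eval (h / 2 * x + (u + h / 2)) := by
    rw [Finset.mul_sum]
    refine Finset.sum_congr rfl fun x hx => ?_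
    have hx' := mem_Ioo_of_root (mem_nodes.mp hx)
    have hne : x ≠ -1 := hx'.1.ne'
    have ep : h / 2 * x + (u + h / 2) = u + h * (x + 1) / 2 := by ring
    have hw : (first (m + 2)).weight x = interiorWeight (m + 2) x := if_neg hne
    rw [hw, ep, hsp, mul_assoc]
    constructor <;> nlinarith [hx'.1, hx'.2]
  rw [e1, e2] at hr
  rw [NodesWeights.sumOn, show (first (m + 2)).nodes
      = insert (-1) (polyR (m + 2)).roots.toFinset from rfl,
    Finset.sum_insert (neg_one_notMem_nodes m), hsum,
    show (first (m + 2)).weight (-1) = endWeight (m + 2) from if_pos rfl,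
    show u + h * (-1 + 1) / 2 = u by ring, integral_congr_Icc huv'.le hsp, hr,
    deriv_eq_of_eqOn_Icc hs huv' hsp hu, deriv_eq_of_eqOn_Icc hs huv' hsp hv, hsp u hu]
  ring

theorem sumOn_second (hs : ContDiff ℝ 1 s) (hp : p.natDegree ≤ 2 * m + 4) (hh : 0 < h)
    (huv : v = u + h) (hsp : ∀ x ∈ Set.Icc u v, s x = p.eval x) :
    (second (m + 2)).sumOn u h s = (∫ x in u..v, s x)
      - h / 2 * (endWeight (m + 2) / 2 * s v - h / 2 * (derivWeightLeft m * deriv s v))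
      + (h / 2) ^ 2 * (derivWeightRight m * deriv s u) := by
  have huv' : u < v := by linarith
  have hu : u ∈ Set.Icc u v := ⟨le_rfl, huv'.le⟩
  have hv : v ∈ Set.Icc u v := ⟨huv'.le, le_rfl⟩
  -- The negative scale reflects the rule: -1 goes to v, and the derivative terms change sign.
  have hr := integral_eq_rule hp (-(h / 2)) (u + h / 2)
  have e1 : u + h / 2 - -(h / 2) = v := by rw [huv]; ring
  have e2 : u + h / 2 + -(h / 2) = u := by ring
  have hsum : (second (m + 2)).sumOn u h s
      = h / 2 * ∑ x ∈ (polyR (m + 2)).roots.toFinset,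
        interiorWeight (m + 2) x * p.eval (-(h / 2) * x + (u + h / 2)) := by
    rw [NodesWeights.sumOn, second, Finset.sum_image neg_injective.injOn, Finset.mul_sum]
    refine Finset.sum_congr rfl fun x hx => ?_
    have hx' := mem_Ioo_of_root (mem_nodes.mp hx)
    have ep : -(h / 2) * x + (u + h / 2) = u + h * (-x + 1) / 2 := by ring
    change h / 2 * interiorWeight (m + 2) (- -x) * _ = _
    rw [neg_neg, ep, hsp, mul_assoc]
    constructor <;> nlinarith [hx'.1, hx'.2]
  rw [e1, e2, intervalIntegral.integral_symm] at hr
  rw [hsum, integral_congr_Icc huv'.le hsp,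
    deriv_eq_of_eqOn_Icc hs huv' hsp hu, deriv_eq_of_eqOn_Icc hs huv' hsp hv, hsp v hv]
  linear_combination hr

end Pieces

/-! ### Bounds for knot values by local integrals -/

theorem polyInt_geg_mul_eq {M : ℕ} {q : ℝ[X]} (hq : q.natDegree ≤ M) :
    polyInt (geg M * q)
      = ((M : ℝ) + 2) * ((M : ℝ) + 3) / 6 * q.eval 1 - (derivative q).eval 1 / 3
        + (-1) ^ M * (((M : ℝ) + 2) * ((M : ℝ) + 3) / 6 * q.eval (-1)
          + (derivative q).eval (-1) / 3) := by
  rw [polyInt_geg_mul (by omega)]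
  simp only [eval_sub, eval_mul, gegF_eval_one, gegF_eval_neg_one, gegE_eval_one,
    gegE_eval_neg_one]
  ring

/-- On polynomials of bounded degree, the value and the derivative at `-1` are integrals against
fixed polynomials. -/
theorem exists_representing_polynomials (D : ℕ) : ∃ φ ψ : ℝ[X], ∀ q : ℝ[X], q.natDegree ≤ D →
    q.eval (-1) = polyInt (φ * q) ∧ (derivative q).eval (-1) = polyInt (ψ * q) := by
  have key : ∀ (a b c d : ℝ) (q : ℝ[X]), polyInt ((C a * geg (2 * D) + C b * geg (2 * D + 1)
      + C c * geg (2 * D + 2) + C d * geg (2 * D + 3)) * q)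
      = a * polyInt (geg (2 * D) * q) + b * polyInt (geg (2 * D + 1) * q)
        + c * polyInt (geg (2 * D + 2) * q) + d * polyInt (geg (2 * D + 3) * q) := by
    intro a b c d q
    simp only [add_mul, map_add, mul_assoc, polyInt_C_mul]
  set M : ℝ := ((2 * D : ℕ) : ℝ) with hM
  have hM0 : 0 ≤ M := Nat.cast_nonneg _
  have hs : (-1 : ℝ) ^ (2 * D) = 1 := by rw [pow_mul]; simp
  have h1 : 4 * M + 14 ≠ 0 := by positivity
  have h2 : 4 * M + 18 ≠ 0 := by positivity
  -- Integrals against C_{M+2} - C_M and C_{M+3} - C_{M+1} give (4M+14)/6 (q(1) + q(-1)) and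
  -- (4M+18)/6 (q(1) - q(-1)); half sum minus half difference is q(-1). For ψ, C_M and C_{M+1}
  -- isolate q'(-1), and the same differences remove the values.
  refine ⟨C (-(3 / (4 * M + 14))) * geg (2 * D) + C (3 / (4 * M + 18)) * geg (2 * D + 1)
      + C (3 / (4 * M + 14)) * geg (2 * D + 2) + C (-(3 / (4 * M + 18))) * geg (2 * D + 3),
    C (3 / 2 * (1 + (M + 2) * (M + 3) / (4 * M + 14))) * geg (2 * D)
      + C (-(3 / 2 * (1 + (M + 3) * (M + 4) / (4 * M + 18)))) * geg (2 * D + 1)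
      + C (-(3 / 2 * ((M + 2) * (M + 3) / (4 * M + 14)))) * geg (2 * D + 2)
      + C (3 / 2 * ((M + 3) * (M + 4) / (4 * M + 18))) * geg (2 * D + 3), fun q hq => ?_⟩
  rw [key, key, polyInt_geg_mul_eq (by omega), polyInt_geg_mul_eq (by omega),
    polyInt_geg_mul_eq (by omega), polyInt_geg_mul_eq (by omega)]
  simp only [pow_succ, hs, ← hM, Nat.cast_add, Nat.cast_one, Nat.cast_ofNat]
  constructor
  · field_simp
    ring
  · field_simp
    ring

theorem exists_abs_polyInt_mul_le (φ : ℝ[X]) : ∃ K : ℝ, 0 ≤ K ∧ ∀ q : ℝ[X],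
    |polyInt (φ * q)| ≤ K * ∫ x in (-1 : ℝ)..1, |q.eval x| := by
  obtain ⟨K, hK⟩ := isCompact_Icc.exists_bound_of_continuousOn
    (s := Set.Icc (-1 : ℝ) 1) φ.continuous.continuousOn
  have hK0 : 0 ≤ K := (norm_nonneg _).trans (hK 0 (by norm_num))
  refine ⟨K, hK0, fun q => ?_⟩
  rw [← intervalIntegral.integral_const_mul]
  have hle : (-1 : ℝ) ≤ 1 := by norm_num
  refine (intervalIntegral.abs_integral_le_integral_abs hle).trans ?_
  refine intervalIntegral.integral_mono_on hle
    ((φ * q).continuous.abs.intervalIntegrable _ _)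
    ((q.continuous.abs.const_mul K).intervalIntegrable _ _) fun x hx => ?_
  rw [eval_mul, abs_mul]
  exact mul_le_mul_of_nonneg_right (hK x hx) (abs_nonneg _)

/-- Rescaling to [-1, 1] makes K independent of u, so integrability of a spline yields summability
of its knot data. -/
theorem exists_endpoint_bound (D : ℕ) {h : ℝ} (hh : 0 < h) : ∃ K : ℝ, 0 ≤ K ∧
    ∀ (p : ℝ[X]) (u : ℝ), p.natDegree ≤ D →
      |p.eval u| ≤ K * ∫ x in u..(u + h), |p.eval x| ∧
      |(derivative p).eval u| ≤ K * ∫ x in u..(u + h), |p.eval x| := by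
  obtain ⟨φ, ψ, hrep⟩ := exists_representing_polynomials D
  obtain ⟨K1, hK1, h1⟩ := exists_abs_polyInt_mul_le φ
  obtain ⟨K2, hK2, h2⟩ := exists_abs_polyInt_mul_le ψ
  refine ⟨max (K1 * (2 / h)) (2 / h * (K2 * (2 / h))), by positivity, fun p u hp => ?_⟩
  set q := p.comp (C (h / 2) * X + C (u + h / 2)) with hq
  have hqd : q.natDegree ≤ D := (natDegree_comp_affine_le p _ _).trans hp
  have e1 : h / 2 * -1 + (u + h / 2) = u := by ring
  have e2 : h / 2 * 1 + (u + h / 2) = u + h := by ring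
  have hint : ∫ x in (-1 : ℝ)..1, |q.eval x| = 2 / h * ∫ x in u..(u + h), |p.eval x| := by
    have := intervalIntegral.smul_integral_comp_mul_add (a := -1) (b := 1)
      (fun x => |p.eval x|) (h / 2) (u + h / 2)
    rw [e1, e2, smul_eq_mul] at this
    rw [← this, hq]
    simp only [eval_comp, eval_add, eval_mul, eval_C, eval_X]
    field_simp
  have hnn : 0 ≤ ∫ x in u..(u + h), |p.eval x| :=
    intervalIntegral.integral_nonneg (by linarith) fun x _ => abs_nonneg _
  have hv : p.eval u = q.eval (-1) := by
    rw [hq, eval_comp]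
    simp only [eval_add, eval_mul, eval_C, eval_X, e1]
  have hd : (derivative p).eval u = 2 / h * (derivative q).eval (-1) := by
    rw [hq, derivative_comp_affine_eval, e1]
    field_simp
  obtain ⟨r1, r2⟩ := hrep q hqd
  constructor
  · have := h1 q
    rw [hint, ← r1, ← hv, ← mul_assoc] at this
    exact this.trans (mul_le_mul_of_nonneg_right (le_max_left _ _) hnn)
  · have := h2 q
    rw [hint, ← r2, ← mul_assoc] at this
    rw [hd, abs_mul, abs_of_pos (by positivity)]
    refine (mul_le_mul_of_nonneg_left this (by positivity)).trans ?_
    rw [← mul_assoc]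
    exact mul_le_mul_of_nonneg_right (le_max_right _ _) hnn

/-! ### Summation over the real line -/

theorem hasSum_integral_uniform {s : ℝ → ℝ} (hs : Integrable s) (a : ℝ) {l : ℝ} (hl : 0 < l) :
    HasSum (fun k : ℤ => ∫ x in (a + k * l)..(a + (k + 1) * l), s x) (∫ x, s x) := by
  have h1 : Integrable (fun x => s (l * x + a)) :=
    (hs.comp_add_right a).comp_mul_left' hl.ne'
  have h2 := (h1.hasSum_intervalIntegral 0).mul_left l
  have h3 : l * ∫ x, s (l * x + a) = ∫ x, s x := by
    rw [Measure.integral_comp_mul_left (fun x => s (x + a)) l, integral_add_right_eq_self,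
      abs_of_pos (by positivity), smul_eq_mul, mul_inv_cancel_left₀ hl.ne']
  rw [h3] at h2
  refine h2.congr_fun fun k => ?_
  have h4 := intervalIntegral.smul_integral_comp_mul_add (a := 0 + (k : ℝ)) (b := 0 + (k : ℝ) + 1)
    s l a
  rw [smul_eq_mul] at h4
  rw [h4]
  congr 1 <;> ring

theorem hasSum_sub_shift {G : ℤ → ℝ} (hG : Summable G) :
    HasSum (fun k => G k - G (k + 1)) 0 := by
  have h1 := hG.hasSum
  have h2 : HasSum (fun k => G (k + 1)) (∑' k, G k) :=
    (Equiv.addRight (1 : ℤ)).hasSum_iff.mpr h1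
  simpa using h1.sub h2

theorem exact_on_splines (m : ℕ) (a h : ℝ) (s : ℝ → ℝ) (hh : 0 < h)
    (hs : IsUniformSpline 1 (2 * (m + 2)) a h s) (hi : Integrable s) :
    HasSum (fun k : ℤ => (first (m + 2)).sumOn (a + 2 * (k : ℝ) * h) h s
      + (second (m + 2)).sumOn (a + (2 * (k : ℝ) + 1) * h) h s) (∫ x, s x) := by
  obtain ⟨hc, hp⟩ := hs
  replace hc : ContDiff ℝ 1 s := by simpa using hc
  -- The boundary terms at the outer knots. Those at the middle knot of a pair involve only s' and
  -- cancel.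
  set G : ℤ → ℝ := fun k => h / 2 * (endWeight (m + 2) / 2 * s (a + k * (2 * h))
    - h / 2 * (derivWeightLeft m * deriv s (a + k * (2 * h)))) with hG
  have hII : ∀ u v, IntervalIntegrable s volume u v := fun u v =>
    hc.continuous.intervalIntegrable u v
  have hterm : ∀ k : ℤ, (first (m + 2)).sumOn (a + 2 * (k : ℝ) * h) h s
      + (second (m + 2)).sumOn (a + (2 * (k : ℝ) + 1) * h) h s
      = (∫ x in (a + k * (2 * h))..(a + (k + 1) * (2 * h)), s x) + (G k - G (k + 1)) := by
    intro k
    obtain ⟨p1, hd1, hp1⟩ := hp (2 * k)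
    obtain ⟨p2, hd2, hp2⟩ := hp (2 * k + 1)
    push_cast at hp1 hp2
    rw [sumOn_first (v := a + (2 * (k : ℝ) + 1) * h) hc (by omega) hh (by ring) hp1,
      sumOn_second (v := a + (2 * (k : ℝ) + 1 + 1) * h) hc (by omega) hh (by ring) hp2]
    have e0 : a + 2 * (k : ℝ) * h = a + k * (2 * h) := by ring
    have e2 : a + (2 * (k : ℝ) + 1 + 1) * h = a + (k + 1) * (2 * h) := by ring
    rw [e0, e2, ← intervalIntegral.integral_add_adjacent_intervals
      (hII (a + k * (2 * h)) (a + (2 * (k : ℝ) + 1) * h)) (hII _ (a + (k + 1) * (2 * h))), hG]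
    push_cast
    ring
  have hsum : Summable G := by
    obtain ⟨K, hK, hb⟩ := exists_endpoint_bound (2 * (m + 2)) hh
    have hA := (hasSum_integral_uniform hi.abs a (show 0 < 2 * h by positivity)).summable
    refine Summable.of_norm_bounded (hA.mul_left
      (h / 2 * (|endWeight (m + 2) / 2| * K + h / 2 * (|derivWeightLeft m| * K)))) fun k => ?_
    obtain ⟨p, hd, hsp⟩ := hp (2 * k)
    push_cast at hsp
    set u := a + (k : ℝ) * (2 * h) with hu
    have e0 : a + 2 * (k : ℝ) * h = u := by rw [hu]; ring
    have e1 : a + (2 * (k : ℝ) + 1) * h = u + h := by rw [hu]; ring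
    have e2 : a + ((k : ℝ) + 1) * (2 * h) = u + h + h := by rw [hu]; ring
    rw [e0, e1] at hsp
    rw [e2]
    have huh : u < u + h := by linarith
    have huI : u ∈ Set.Icc u (u + h) := ⟨le_rfl, huh.le⟩
    obtain ⟨b1, b2⟩ := hb p u hd
    have hI : ∫ x in u..(u + h), |p.eval x| ≤ ∫ x in u..(u + h + h), |s x| := by
      have : ∫ x in u..(u + h), |p.eval x| = ∫ x in u..(u + h), |s x| :=
        intervalIntegral.integral_congr fun x hx => by
          rw [Set.uIcc_of_le huh.le] at hx
          simp only [hsp x hx]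
      rw [this, ← intervalIntegral.integral_add_adjacent_intervals
        ((hII u (u + h)).abs) ((hII (u + h) (u + h + h)).abs)]
      exact le_add_of_nonneg_right
        (intervalIntegral.integral_nonneg (by linarith) fun x _ => abs_nonneg _)
    rw [← hsp u huI] at b1
    rw [← deriv_eq_of_eqOn_Icc hc huh hsp huI] at b2
    replace b1 := b1.trans (mul_le_mul_of_nonneg_left hI hK)
    replace b2 := b2.trans (mul_le_mul_of_nonneg_left hI hK)
    rw [hG, Real.norm_eq_abs, abs_mul, abs_of_pos (half_pos hh), mul_assoc]
    refine mul_le_mul_of_nonneg_left ?_ (half_pos hh).le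
    refine (abs_sub _ _).trans ?_
    rw [abs_mul, abs_mul, abs_mul, abs_of_pos (half_pos hh), add_mul, mul_assoc, mul_assoc,
      mul_assoc]
    gcongr
  have := (hasSum_integral_uniform hi a (show 0 < 2 * h by positivity)).add (hasSum_sub_shift hsum)
  rw [add_zero] at this
  exact this.congr_fun hterm

end HalfRule

end

theorem mainTheorem5 (n : ℕ) (hn : 2 ≤ n) :
    -- `R_{n-1}` has degree `n - 1` and exactly `n - 1` roots, all simple and in `(-1, 1)`,
    -- and no denominator of an interior weight vanishes
    ((HalfRule.polyR n).natDegree = n - 1 ∧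
      (HalfRule.polyR n).roots.card = n - 1 ∧
      (HalfRule.polyR n).roots.Nodup ∧
      ∀ x ∈ (HalfRule.polyR n).roots, x ∈ Set.Ioo (-1 : ℝ) 1 ∧
        (Polynomial.derivative (HalfRule.polyR n)).eval x ≠ 0 ∧
        (HalfRule.polyS n).eval x ≠ 0) ∧
    -- the numbers of nodes on the two intervals
    (HalfRule.first n).nodes.card = n ∧
    (HalfRule.second n).nodes.card = n - 1 ∧
    -- the rule with period two intervals is exact on the real line
    ∀ (a h : ℝ) (s : ℝ → ℝ), 0 < h → IsUniformSpline 1 (2 * n) a h s →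
      MeasureTheory.Integrable s MeasureTheory.volume →
      HasSum (fun k : ℤ =>
          (HalfRule.first n).sumOn (a + 2 * (k : ℝ) * h) h s
            + (HalfRule.second n).sumOn (a + (2 * (k : ℝ) + 1) * h) h s)
        (∫ x, s x) := by
  obtain ⟨m, rfl⟩ : ∃ m, n = m + 2 := ⟨n - 2, by omega⟩
  obtain ⟨hc, hd, -⟩ := HalfRule.polyR_roots m
  refine ⟨⟨HalfRule.natDegree_polyR m, hc, hd, fun x hx => ?_⟩, HalfRule.card_first m,
    HalfRule.card_second m, HalfRule.exact_on_splines m⟩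
  have hx' := (mem_roots (HalfRule.polyR_ne_zero m)).mp hx
  exact ⟨HalfRule.mem_Ioo_of_root hx', HalfRule.polyR_derivative_ne_zero hx',
    HalfRule.polyS_ne_zero hx'⟩
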